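/- Let $A_0,A_1,b_0,b_1$ be non-negative integers, not all zero, and let $(f(n))_{n\ge 1}$ be a sequence of non-negative integers, not identically zero, with $$f(2n)=A_0f(n)+b_0,\qquad f(2n+1)=A_1f(n)+b_1\qquad (n\ge 1),$$ where the initial value $f(1)$ is arbitrary. On the torus $\mathbb{T}=\mathbb{R}/\mathbb{Z}$, with normalised Lebesgue measure $\lambda$, put $$\mu_N=\frac{1}{\Sigma(N)}\sum_{n=0}^{2^N-1} f(2^N+n)\,\delta_{n/2^N},\qquad \Sigma(N)=\sum_{n=0}^{2^N-1}f(2^N+n)$$ ($\Sigma(N)>0$ for all $N\ge 1$). Then the ghost measure $\mu$ of $f$ exists: there is exactly one finite Borel measure $\mu$ on $\mathbb{T}$ with $\int g\,d\mu_N\to\int g\,d\mu$ for every continuous $g:\mathbb{T}\to\mathbb{R}$. It is a probability measure, and its Lebesgue type is as follows. 1. Suppose $b_0=b_1=0$. (A) If $A_0=A_1\ne 0$, then $\mu=\lambda$. (B) If $A_0\ne A_1$ and neither is $0$, then $\mu$ is singular continuous. (C) If $A_0=0$ or $A_1=0$, then $\mu$ is pure point, and $\mu=\delta_0$. 2. Suppose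 $b_0+b_1\ne 0$. (A) If $A_0+A_1\le 2$, then $\mu=\lambda$. (B) If $A_0=A_1>1$, then $\mu$ is absolutely continuous. (C) If $A_0\ne A_1$ and neither is $0$, then $\mu$ is singular continuous. (D) If one of $A_0,A_1$ is $0$ and the other is greater than $2$, then $\mu$ is pure point. Here a finite Borel measure on $\mathbb{T}$ is called pure point if it is a countable sum of weighted Dirac measures, absolutely continuous if it is of the form $g\,\lambda$ with $0\le g\in L^1(\mathbb{T})$, and singular continuous if it has no atoms and is concentrated on a set of Lebesgue measure zero. -/

import Mathlib

open MeasureTheory Filter Topology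
open scoped ENNReal

/-- `f` is an affine `2`-regular sequence with coefficients `A₀, A₁, b₀, b₁`.  The sequence starts
at `f 1`, which is a free initial value; the relations are not imposed at `n = 0`, where they may
be inconsistent. -/
def IsAffineTwoRegular (A₀ A₁ b₀ b₁ : ℕ) (f : ℕ → ℕ) : Prop :=
  ∀ n : ℕ, 1 ≤ n → f (2 * n) = A₀ * f n + b₀ ∧ f (2 * n + 1) = A₁ * f n + b₁

/-- The sum of `f` over the fundamental region `[2 ^ N, 2 ^ (N + 1))`. -/
def levelSum (f : ℕ → ℕ) (N : ℕ) : ℕ :=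
  ∑ n ∈ Finset.range (2 ^ N), f (2 ^ N + n)

/-- The `N`-th approximant to the ghost measure: the Dirac comb on the torus with weight
`f (2 ^ N + n)` at the point `n / 2 ^ N`, divided by its total mass.
(It is the zero measure if that total mass vanishes.) -/
noncomputable def ghostApprox (f : ℕ → ℕ) (N : ℕ) : Measure UnitAddCircle :=
  (levelSum f N : ℝ≥0∞)⁻¹ •
    ∑ n ∈ Finset.range (2 ^ N),
      (f (2 ^ N + n) : ℝ≥0∞) • Measure.dirac (((n : ℝ) / 2 ^ N : ℝ) : UnitAddCircle)

/-- The finite Borel measure `μ` on the torus is the vague limit of the measures `ν N`. -/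
def IsVagueLimit (ν : ℕ → Measure UnitAddCircle) (μ : Measure UnitAddCircle) : Prop :=
  IsFiniteMeasure μ ∧
    ∀ g : UnitAddCircle → ℝ, Continuous g →
      Tendsto (fun N => ∫ x, g x ∂(ν N)) atTop (𝓝 (∫ x, g x ∂μ))

/-- `μ` is the ghost measure of `f`. -/
def IsGhostMeasure (f : ℕ → ℕ) (μ : Measure UnitAddCircle) : Prop :=
  IsVagueLimit (ghostApprox f) μ

/-- Pure point: a countable sum of weighted Dirac measures (weights may be zero, so that finite
sums are included). -/
def IsPurePoint (μ : Measure UnitAddCircle) : Prop :=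
  ∃ (c : ℕ → ℝ≥0∞) (x : ℕ → UnitAddCircle), μ = Measure.sum fun i => c i • Measure.dirac (x i)

/-- Singular continuous: no point has positive mass, and the measure is concentrated on a set of
Lebesgue measure zero. -/
def IsSingularContinuous (μ : Measure UnitAddCircle) : Prop :=
  (∀ x : UnitAddCircle, μ {x} = 0) ∧ μ ⟂ₘ (volume : Measure UnitAddCircle)

/-- Absolutely continuous: there is an integrable density with respect to Lebesgue measure. -/
def IsAbsContinuous (μ : Measure UnitAddCircle) : Prop :=
  ∃ g : UnitAddCircle → ℝ, Integrable g volume ∧ (∀ x, 0 ≤ g x) ∧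
    μ = (volume : Measure UnitAddCircle).withDensity fun x => ENNReal.ofReal (g x)

/-! ### Dyadic branches and self-similar families of measures -/

/-! The integers `m ≥ 1` form a binary tree in which `m` has children `2m` and `2m+1`, and level `N`
of the tree is laid out from left to right on the dyadic points. With `A = A₀+A₁` and `B = b₀+b₁`,
the sum `S_j(m)` of `f` over the descendants of `m` at depth `j` satisfies `S_{j+1} = A S_j + 2^j
B`. Dividing by the right growth rate `c_j`, namely `A^j`, `2^j` or `j 2^j` up to a constant, gives
a limit weight `w(m)`.

Suppose measures `M m` on the unit interval have masses `w(m)` and split along children with factor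
`α = lim c_j / c_{j+1}`. A continuous function integrated against the rescaled comb, or against `M
1`, is then close to one and the same Riemann sum at depth `k` (`tendsto_weightedLevelSum_div`), so
the normalised `M 1` is the ghost measure.

If `B ≠ 0` and `A ≤ 2`, the weights do not depend on `m`, and every `M m` can be Lebesgue measure.
Otherwise `w(m) = f(m) + B/(A-2)` (just `f(m)` if `B = 0`), and `M m = f(m) β + σ`: here `β` is
stationary for choosing the halves with probabilities `A₀/A` and `A₁/A`, and `σ` superposes copies
of `β` created by `b₀, b₁` at the nodes (`isDyadicFamily_nodeMeasure`).

Scaling, countable sums and dyadic contractions preserve each Lebesgue type, so `M 1` inherits the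
type of `β` (`induction_sourceSum`). This `β` is Lebesgue measure if `A₀ = A₁`, a point mass at an
endpoint if one coefficient vanishes, and otherwise a biased Bernoulli measure. The last has no
atoms and, by the strong law of large numbers, lives on numbers with digit frequency `A₁/A ≠ 1/2`, a
Lebesgue null set by the same law for a fair coin. -/

theorem sum_range_mul_eq_sum_sum {M : Type*} [AddCommMonoid M] (a b : ℕ) (F : ℕ → M) :
    ∑ x ∈ Finset.range (a * b), F x =
      ∑ i ∈ Finset.range a, ∑ n ∈ Finset.range b, F (i * b + n) := by
  induction a with
  | zero => simp
  | succ a ih => rw [Nat.succ_mul, Finset.sum_range_add, ih, Finset.sum_range_succ]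

/-- The affine contraction of the unit interval onto the `n`-th dyadic interval of level `k`. -/
noncomputable def dyadicBranch (k n : ℕ) (x : ℝ) : ℝ := (x + n) / 2 ^ k

theorem continuous_dyadicBranch (k n : ℕ) : Continuous (dyadicBranch k n) := by
  unfold dyadicBranch; fun_prop

theorem measurable_dyadicBranch (k n : ℕ) : Measurable (dyadicBranch k n) :=
  (continuous_dyadicBranch k n).measurable

theorem dyadicBranch_injective (k n : ℕ) : Function.Injective (dyadicBranch k n) := by
  intro x y h
  have h2 : (2 : ℝ) ^ k ≠ 0 := by positivity
  simpa [dyadicBranch, div_left_inj' h2] using h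

theorem dyadicBranch_mem_Icc {k n : ℕ} (hn : n < 2 ^ k) {x : ℝ} (hx : x ∈ Set.Icc (0 : ℝ) 1) :
    dyadicBranch k n x ∈ Set.Icc (0 : ℝ) 1 := by
  have h2 : (0 : ℝ) < 2 ^ k := by positivity
  have hn' : (n : ℝ) + 1 ≤ 2 ^ k := by exact_mod_cast hn
  have hn0 : (0 : ℝ) ≤ n := Nat.cast_nonneg n
  constructor
  · exact div_nonneg (by linarith [hx.1]) h2.le
  · rw [dyadicBranch, div_le_one h2]; linarith [hx.2]

theorem dyadicBranch_comp (k n l d : ℕ) :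
    dyadicBranch k n ∘ dyadicBranch l d = dyadicBranch (k + l) (n * 2 ^ l + d) := by
  ext x
  simp only [Function.comp, dyadicBranch]
  push_cast
  field_simp
  ring

theorem exists_oscillation_le {h : ℝ → ℝ} (hc : Continuous h) {ε : ℝ} (hε : 0 < ε) :
    ∃ k : ℕ, ∀ i < 2 ^ k, ∀ x ∈ Set.Icc (0 : ℝ) 1,
      |h (dyadicBranch k i x) - h (dyadicBranch k i 0)| ≤ ε := by
  have hu := (isCompact_Icc (a := (0 : ℝ)) (b := 1)).uniformContinuousOn_of_continuous
    hc.continuousOn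
  obtain ⟨δ, hδ, H⟩ := Metric.uniformContinuousOn_iff.1 hu ε hε
  obtain ⟨k, hk⟩ := exists_pow_lt_of_lt_one hδ (by norm_num : (1 / 2 : ℝ) < 1)
  refine ⟨k, fun i hi x hx => ?_⟩
  refine (H _ (dyadicBranch_mem_Icc hi hx) _ (dyadicBranch_mem_Icc hi (by simp)) ?_).le
  have h2 : (0 : ℝ) < 2 ^ k := by positivity
  have : dyadicBranch k i x - dyadicBranch k i 0 = x * (1 / 2) ^ k := by
    simp only [dyadicBranch, one_div, inv_pow]; field_simp; ring
  rw [Real.dist_eq, this, abs_of_nonneg (mul_nonneg hx.1 (by positivity))]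
  calc x * (1 / 2) ^ k ≤ 1 * (1 / 2) ^ k := by gcongr; exact hx.2
    _ < δ := by rwa [one_mul]

/-- A family of finite measures on the unit interval, indexed by the nodes `m ≥ 1` of the binary
tree, each of which is up to a factor `α` assembled from the measures at the two children. -/
structure IsDyadicFamily (α : ℝ≥0∞) (M : ℕ → Measure ℝ) : Prop where
  finite : ∀ m, IsFiniteMeasure (M m)
  compl_Icc : ∀ m, M m (Set.Icc 0 1)ᶜ = 0
  split : ∀ m, 1 ≤ m → M m = α • ((M (2 * m)).map (dyadicBranch 1 0) +
    (M (2 * m + 1)).map (dyadicBranch 1 1))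

namespace IsDyadicFamily

variable {α : ℝ≥0∞} {M : ℕ → Measure ℝ}

theorem eq_sum (hM : IsDyadicFamily α M) (k : ℕ) :
    M 1 = α ^ k • ∑ i ∈ Finset.range (2 ^ k), (M (2 ^ k + i)).map (dyadicBranch k i) := by
  induction k with
  | zero =>
    have : dyadicBranch 0 0 = id := by ext x; simp [dyadicBranch]
    simp [this]
  | succ k ih =>
    rw [ih, pow_succ 2 k, sum_range_mul_eq_sum_sum, pow_succ α, mul_smul, Finset.smul_sum (r := α)]
    congr 1
    refine Finset.sum_congr rfl fun i _ => ?_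
    rw [hM.split _ (by have := Nat.one_le_two_pow (n := k); omega), Measure.map_smul,
      Measure.map_add _ _ (measurable_dyadicBranch _ _),
      Measure.map_map (measurable_dyadicBranch _ _) (measurable_dyadicBranch _ _),
      Measure.map_map (measurable_dyadicBranch _ _) (measurable_dyadicBranch _ _),
      dyadicBranch_comp, dyadicBranch_comp]
    simp only [Finset.sum_range_succ, Finset.sum_range_zero, zero_add, pow_one, add_zero]
    ring_nf

/-- Unfolding `M 1` to depth `k` places each leaf inside one dyadic interval, where `h` is within
`ε` of its value at the left endpoint. The Riemann sum involves the family only through its masses.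
-/
theorem abs_integral_sub_sum_le (hM : IsDyadicFamily α M) {h : ℝ → ℝ} (hc : Continuous h)
    {C : ℝ} (hb : ∀ x, |h x| ≤ C) {ε : ℝ} {k : ℕ}
    (hk : ∀ i < 2 ^ k, ∀ x ∈ Set.Icc (0 : ℝ) 1,
      |h (dyadicBranch k i x) - h (dyadicBranch k i 0)| ≤ ε) :
    |∫ x, h x ∂(M 1) - ∑ i ∈ Finset.range (2 ^ k),
        (α ^ k).toReal * (M (2 ^ k + i)).real Set.univ * h (dyadicBranch k i 0)|
      ≤ ε * (M 1).real Set.univ := by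
  have := hM.finite
  have hint : ∀ (ν : Measure ℝ) [IsFiniteMeasure ν], Integrable h ν := fun ν _ =>
    Integrable.of_bound hc.aestronglyMeasurable C (Eventually.of_forall hb)
  have hmass : (M 1).real Set.univ =
      ∑ i ∈ Finset.range (2 ^ k), (α ^ k).toReal * (M (2 ^ k + i)).real Set.univ := by
    conv_lhs => rw [hM.eq_sum k]
    rw [← Finset.mul_sum, measureReal_def, Measure.smul_apply, smul_eq_mul, ENNReal.toReal_mul,
      Measure.finsetSum_apply, ENNReal.toReal_sum (fun i _ => measure_ne_top _ _)]
    congr 1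
    refine Finset.sum_congr rfl fun i _ => ?_
    rw [Measure.map_apply (measurable_dyadicBranch _ _) MeasurableSet.univ]
    rfl
  have hI : ∫ x, h x ∂(M 1) = ∑ i ∈ Finset.range (2 ^ k),
      (α ^ k).toReal * ∫ x, h (dyadicBranch k i x) ∂(M (2 ^ k + i)) := by
    conv_lhs => rw [hM.eq_sum k]
    rw [integral_smul_measure, integral_finsetSum_measure (fun i _ => hint _), smul_eq_mul,
      Finset.mul_sum]
    refine Finset.sum_congr rfl fun i _ => ?_
    rw [integral_map (measurable_dyadicBranch _ _).aemeasurable hc.aestronglyMeasurable]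
  rw [hI, hmass, ← Finset.sum_sub_distrib, Finset.mul_sum]
  refine (Finset.abs_sum_le_sum_abs _ _).trans (Finset.sum_le_sum fun i hi => ?_)
  have hi' := Finset.mem_range.1 hi
  have key : |∫ x, (h (dyadicBranch k i x) - h (dyadicBranch k i 0)) ∂(M (2 ^ k + i))| ≤
      ε * (M (2 ^ k + i)).real Set.univ := by
    rw [← Real.norm_eq_abs]
    refine norm_integral_le_of_norm_le_const ?_
    have : ∀ᵐ x ∂(M (2 ^ k + i)), x ∈ Set.Icc (0 : ℝ) 1 := hM.compl_Icc _
    filter_upwards [this] with x hx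
    exact hk i hi' x hx
  have hint' : Integrable (fun x => h (dyadicBranch k i x)) (M (2 ^ k + i)) :=
    Integrable.of_bound (hc.comp (continuous_dyadicBranch k i)).aestronglyMeasurable C
      (Eventually.of_forall fun x => hb _)
  rw [integral_sub hint' (integrable_const _), integral_const, smul_eq_mul] at key
  rw [mul_assoc, ← mul_sub, abs_mul, abs_of_nonneg ENNReal.toReal_nonneg]
  calc _ ≤ (α ^ k).toReal * (ε * (M (2 ^ k + i)).real Set.univ) := by gcongr
    _ = _ := by ring

end IsDyadicFamily

theorem IsDyadicFamily.ext {α : ℝ≥0∞} {M M' : ℕ → Measure ℝ} (hM : IsDyadicFamily α M)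
    (hM' : IsDyadicFamily α M') (h : ∀ m, M m Set.univ = M' m Set.univ) : M 1 = M' 1 := by
  have := hM.finite
  have := hM'.finite
  refine ext_of_forall_integral_eq_of_IsFiniteMeasure fun g => ?_
  have hreal : ∀ m, (M' m).real Set.univ = (M m).real Set.univ := fun m => by
    simp [measureReal_def, h]
  refine eq_of_forall_dist_le fun ε hε => ?_
  set W := (M 1).real Set.univ
  have hW : 0 ≤ W := measureReal_nonneg
  -- Each family costs an error of at most `ε / 2`; the `+ 1` covers `W = 0`.
  obtain ⟨k, hk⟩ := exists_oscillation_le g.continuous (ε := ε / (2 * (W + 1))) (by positivity)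
  have h1 := hM.abs_integral_sub_sum_le g.continuous (C := ‖g‖) g.norm_coe_le_norm hk
  have h2 := hM'.abs_integral_sub_sum_le g.continuous (C := ‖g‖) g.norm_coe_le_norm hk
  simp only [hreal] at h2
  have h3 : ε / (2 * (W + 1)) * W ≤ ε / 2 := by
    rw [div_mul_eq_mul_div, div_le_div_iff₀ (by positivity) (by positivity)]
    nlinarith
  rw [Real.dist_eq]
  rw [abs_le] at *
  constructor <;> linarith [h1.1, h1.2, h2.1, h2.2]

/-! ### Convergence of the approximants -/

/-- The sum of `f` over the descendants at depth `j` of the node `m` of the binary tree. -/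
def descendantSum (f : ℕ → ℕ) (j m : ℕ) : ℕ :=
  ∑ n ∈ Finset.range (2 ^ j), f (2 ^ j * m + n)

theorem levelSum_eq_descendantSum (f : ℕ → ℕ) (N : ℕ) : levelSum f N = descendantSum f N 1 := by
  simp [levelSum, descendantSum]

theorem levelSum_add (f : ℕ → ℕ) (k j : ℕ) :
    levelSum f (k + j) = ∑ i ∈ Finset.range (2 ^ k), descendantSum f j (2 ^ k + i) := by
  rw [levelSum, pow_add, sum_range_mul_eq_sum_sum]
  simp only [descendantSum]
  refine Finset.sum_congr rfl fun i _ => Finset.sum_congr rfl fun n _ => ?_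
  ring_nf

/-- The integral of `h` against the Dirac comb of level `N`, before normalisation. -/
noncomputable def weightedLevelSum (f : ℕ → ℕ) (h : ℝ → ℝ) (N : ℕ) : ℝ :=
  ∑ n ∈ Finset.range (2 ^ N), (f (2 ^ N + n) : ℝ) * h (n / 2 ^ N)

/-- Discrete counterpart of `IsDyadicFamily.abs_integral_sub_sum_le`: the comb points are grouped by
their ancestor at level `k`. -/
theorem abs_weightedLevelSum_sub_le (f : ℕ → ℕ) {h : ℝ → ℝ} {ε : ℝ} {k : ℕ} (j : ℕ)
    (hk : ∀ i < 2 ^ k, ∀ x ∈ Set.Icc (0 : ℝ) 1,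
      |h (dyadicBranch k i x) - h (dyadicBranch k i 0)| ≤ ε) :
    |weightedLevelSum f h (k + j) - ∑ i ∈ Finset.range (2 ^ k),
        (descendantSum f j (2 ^ k + i) : ℝ) * h (dyadicBranch k i 0)|
      ≤ ε * levelSum f (k + j) := by
  rw [levelSum_add, weightedLevelSum, pow_add, sum_range_mul_eq_sum_sum, ← Finset.sum_sub_distrib]
  push_cast
  rw [Finset.mul_sum]
  refine (Finset.abs_sum_le_sum_abs _ _).trans (Finset.sum_le_sum fun i hi => ?_)
  simp only [descendantSum]
  push_cast
  rw [Finset.sum_mul, ← Finset.sum_sub_distrib, Finset.mul_sum]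
  refine (Finset.abs_sum_le_sum_abs _ _).trans (Finset.sum_le_sum fun n hn => ?_)
  have e1 : 2 ^ k * 2 ^ j + (i * 2 ^ j + n) = 2 ^ j * (2 ^ k + i) + n := by ring
  have e2 : ((i : ℝ) * 2 ^ j + n) / 2 ^ (k + j) = dyadicBranch k i ((n : ℝ) / 2 ^ j) := by
    simp only [dyadicBranch, pow_add]; field_simp; ring
  rw [e1, e2, ← mul_sub, abs_mul, Nat.abs_cast, mul_comm ε]
  have hn' : (n : ℝ) ≤ 2 ^ j := by exact_mod_cast (Finset.mem_range.1 hn).le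
  gcongr
  exact hk i (Finset.mem_range.1 hi) _ ⟨by positivity, (div_le_one (by positivity)).2 hn'⟩

theorem tendsto_weightedLevelSum_div {α : ℝ≥0∞} {M : ℕ → Measure ℝ} (hM : IsDyadicFamily α M)
    {f : ℕ → ℕ} {c : ℕ → ℝ} (hc0 : ∀ᶠ j in atTop, 0 < c j)
    (hc : ∀ k, Tendsto (fun j => c j / c (j + k)) atTop (𝓝 (α ^ k).toReal))
    (hw : ∀ m, 1 ≤ m →
      Tendsto (fun j => (descendantSum f j m : ℝ) / c j) atTop (𝓝 ((M m).real Set.univ)))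
    {h : ℝ → ℝ} (hcont : Continuous h) {C : ℝ} (hb : ∀ x, |h x| ≤ C) :
    Tendsto (fun N => weightedLevelSum f h N / c N) atTop (𝓝 (∫ x, h x ∂(M 1))) := by
  set W := (M 1).real Set.univ with hWdef
  have hW : 0 ≤ W := measureReal_nonneg
  rw [Metric.tendsto_atTop']
  intro ε hε
  -- The errors are `e * (W + 1)` for the comb, `e` for the convergence of the finite sum and `e *
  -- W` for the measure.
  set e := ε / (2 * W + 3) with he
  have he0 : 0 < e := by positivity
  obtain ⟨k, hk⟩ := exists_oscillation_le hcont he0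
  have h1 := hM.abs_integral_sub_sum_le hcont hb hk
  have hS : Tendsto (fun j => (levelSum f (j + k) : ℝ) / c (j + k)) atTop (𝓝 W) := by
    have := hw 1 le_rfl
    simp only [← levelSum_eq_descendantSum] at this
    exact (tendsto_add_atTop_iff_nat k).2 this
  have hmid : Tendsto (fun j => ∑ i ∈ Finset.range (2 ^ k),
      (c j / c (j + k)) * ((descendantSum f j (2 ^ k + i) : ℝ) / c j) * h (dyadicBranch k i 0))
      atTop (𝓝 (∑ i ∈ Finset.range (2 ^ k),
        (α ^ k).toReal * (M (2 ^ k + i)).real Set.univ * h (dyadicBranch k i 0))) := by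
    refine tendsto_finsetSum _ fun i _ => ((hc k).mul (hw _ ?_)).mul_const _
    have := Nat.one_le_two_pow (n := k)
    omega
  have ev1 := hS.eventually (gt_mem_nhds (show W < W + 1 by linarith))
  have ev2 := Metric.tendsto_nhds.1 hmid e he0
  have ev3 : ∀ᶠ j in atTop, 0 < c (j + k) := (tendsto_add_atTop_nat k).eventually hc0
  have ev : ∀ᶠ j in atTop, dist (weightedLevelSum f h (j + k) / c (j + k)) (∫ x, h x ∂(M 1)) < ε := by
    filter_upwards [ev1, ev2, ev3, hc0] with j a1 a2 a3 a4
    have b := abs_weightedLevelSum_sub_le f j hk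
    rw [add_comm k j] at b
    have b' : |weightedLevelSum f h (j + k) / c (j + k) - ∑ i ∈ Finset.range (2 ^ k),
        (c j / c (j + k)) * ((descendantSum f j (2 ^ k + i) : ℝ) / c j) * h (dyadicBranch k i 0)|
        ≤ e * (levelSum f (j + k) / c (j + k)) := by
      have : ∑ i ∈ Finset.range (2 ^ k),
        (c j / c (j + k)) * ((descendantSum f j (2 ^ k + i) : ℝ) / c j) * h (dyadicBranch k i 0)
        = (∑ i ∈ Finset.range (2 ^ k),
          (descendantSum f j (2 ^ k + i) : ℝ) * h (dyadicBranch k i 0)) / c (j + k) := by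
        rw [Finset.sum_div]
        refine Finset.sum_congr rfl fun i _ => ?_
        field_simp
      rw [this, ← sub_div, abs_div, abs_of_pos a3, ← mul_div_assoc]
      gcongr
    have b'' : e * (levelSum f (j + k) / c (j + k)) ≤ e * (W + 1) := by gcongr
    have he' : e * (2 * W + 3) = ε := by rw [he]; field_simp
    rw [Real.dist_eq] at a2 ⊢
    rw [abs_le] at h1 b'
    rw [abs_lt] at a2 ⊢
    constructor <;> nlinarith
  obtain ⟨n, hn⟩ := eventually_atTop.1 ev
  refine ⟨n + k, fun m hm => ?_⟩
  have := hn (m - k) (by omega)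
  rwa [Nat.sub_add_cancel (by omega)] at this

theorem integral_ghostApprox (f : ℕ → ℕ) (N : ℕ) {g : UnitAddCircle → ℝ} (hg : Continuous g) :
    ∫ x, g x ∂(ghostApprox f N) = weightedLevelSum f (fun x : ℝ => g x) N / levelSum f N := by
  have hb : ∀ x, ‖g x‖ ≤ ‖BoundedContinuousFunction.mkOfCompact ⟨g, hg⟩‖ :=
    (BoundedContinuousFunction.mkOfCompact ⟨g, hg⟩).norm_coe_le_norm
  have hint : ∀ (ν : Measure UnitAddCircle) [IsFiniteMeasure ν], Integrable g ν := fun ν _ =>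
    Integrable.of_bound hg.aestronglyMeasurable _ (Eventually.of_forall hb)
  have hint' : ∀ (n : ℕ) (x : UnitAddCircle),
      Integrable g ((n : ℝ≥0∞) • Measure.dirac x) := fun n x =>
    (hint _).smul_measure (ENNReal.natCast_ne_top n)
  -- A vanishing `levelSum` is harmless: `∞.toReal = 0` agrees with real division by zero.
  rw [ghostApprox, integral_smul_measure, integral_finsetSum_measure (fun i _ => hint' _ _),
    weightedLevelSum, smul_eq_mul, ENNReal.toReal_inv, ENNReal.toReal_natCast, div_eq_inv_mul]
  congr 1
  refine Finset.sum_congr rfl fun i _ => ?_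
  rw [integral_smul_measure, integral_dirac, ENNReal.toReal_natCast, smul_eq_mul]

/-- The measure on the torus obtained from `μ` by normalising and projecting. -/
noncomputable def normalizedPush (μ : Measure ℝ) : Measure UnitAddCircle :=
  ((μ Set.univ)⁻¹ • μ).map ((↑) : ℝ → UnitAddCircle)

theorem isProbabilityMeasure_normalizedPush {μ : Measure ℝ} [IsFiniteMeasure μ] [NeZero μ] :
    IsProbabilityMeasure (normalizedPush μ) :=
  Measure.isProbabilityMeasure_map (AddCircle.measurable_mk').aemeasurable

/-- Numerator and total mass have the same growth rate `c`, which cancels in the quotient. -/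
theorem IsDyadicFamily.isGhostMeasure {α : ℝ≥0∞} {M : ℕ → Measure ℝ} (hM : IsDyadicFamily α M)
    (h1 : M 1 ≠ 0) {f : ℕ → ℕ} {c : ℕ → ℝ} (hc0 : ∀ᶠ j in atTop, 0 < c j)
    (hc : ∀ k, Tendsto (fun j => c j / c (j + k)) atTop (𝓝 (α ^ k).toReal))
    (hw : ∀ m, 1 ≤ m →
      Tendsto (fun j => (descendantSum f j m : ℝ) / c j) atTop (𝓝 ((M m).real Set.univ))) :
    IsGhostMeasure f (normalizedPush (M 1)) := by
  have := hM.finite 1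
  have : NeZero (M 1) := ⟨h1⟩
  have := isProbabilityMeasure_normalizedPush (μ := M 1)
  refine ⟨inferInstance, fun g hg => ?_⟩
  simp only [integral_ghostApprox f _ hg]
  have hmk : Continuous ((↑) : ℝ → UnitAddCircle) := AddCircle.continuous_mk' 1
  rw [normalizedPush, integral_map hmk.measurable.aemeasurable hg.aestronglyMeasurable,
    integral_smul_measure, smul_eq_mul, ENNReal.toReal_inv, ← div_eq_inv_mul]
  have hnum := tendsto_weightedLevelSum_div hM hc0 hc hw (hg.comp hmk)
    (C := ‖BoundedContinuousFunction.mkOfCompact ⟨g, hg⟩‖)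
    (fun x => (BoundedContinuousFunction.mkOfCompact ⟨g, hg⟩).norm_coe_le_norm _)
  have hden := hw 1 le_rfl
  simp only [← levelSum_eq_descendantSum] at hden
  have hpos : (M 1).real Set.univ ≠ 0 := by
    simp [measureReal_def, ENNReal.toReal_eq_zero_iff, h1]
  refine (hnum.div hden hpos).congr' ?_
  filter_upwards [hc0] with N hN
  exact div_div_div_cancel_right₀ hN.ne' _ _

theorem IsGhostMeasure.unique {f : ℕ → ℕ} {μ ν : Measure UnitAddCircle} (hμ : IsGhostMeasure f μ)
    (hν : IsGhostMeasure f ν) : ν = μ := by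
  have := hμ.1
  have := hν.1
  exact ext_of_forall_integral_eq_of_IsFiniteMeasure fun g =>
    tendsto_nhds_unique (hν.2 g g.continuous) (hμ.2 g g.continuous)

/-! ### Growth of the level sums -/

namespace IsAffineTwoRegular

variable {A₀ A₁ b₀ b₁ : ℕ} {f : ℕ → ℕ}

theorem descendantSum_succ (hf : IsAffineTwoRegular A₀ A₁ b₀ b₁ f) {m : ℕ} (hm : 1 ≤ m) (j : ℕ) :
    descendantSum f (j + 1) m = (A₀ + A₁) * descendantSum f j m + 2 ^ j * (b₀ + b₁) := by
  have hterm : ∀ i, f (2 ^ (j + 1) * m + (i * 2 + 0)) + f (2 ^ (j + 1) * m + (i * 2 + 1)) =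
      (A₀ + A₁) * f (2 ^ j * m + i) + (b₀ + b₁) := fun i => by
    have h1 : 1 ≤ 2 ^ j * m + i := by
      have : 0 < 2 ^ j * m := by positivity
      omega
    obtain ⟨e0, e1⟩ := hf _ h1
    have a0 : 2 ^ (j + 1) * m + (i * 2 + 0) = 2 * (2 ^ j * m + i) := by ring
    have a1 : 2 ^ (j + 1) * m + (i * 2 + 1) = 2 * (2 ^ j * m + i) + 1 := by ring
    rw [a0, a1, e0, e1]; ring
  rw [descendantSum]
  conv_lhs => rw [pow_succ 2 j, sum_range_mul_eq_sum_sum]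
  simp only [← pow_succ, Finset.sum_range_succ, Finset.sum_range_zero, zero_add, hterm]
  rw [Finset.sum_add_distrib, ← Finset.mul_sum]
  simp [descendantSum]

/-- The general solution of the recursion is a multiple of `A^j` plus a particular solution
proportional to `2^j`. At `A = 2` the two resonate, which produces the factor `j` in
`descendantSum_eq_of_add_eq_two`. -/
theorem descendantSum_eq (hf : IsAffineTwoRegular A₀ A₁ b₀ b₁ f) {m : ℕ} (hm : 1 ≤ m)
    (hA : A₀ + A₁ ≠ 2) (j : ℕ) :
    (descendantSum f j m : ℝ) = (A₀ + A₁ : ℝ) ^ j * (f m + (b₀ + b₁ : ℝ) / (A₀ + A₁ - 2)) -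
      2 ^ j * ((b₀ + b₁ : ℝ) / (A₀ + A₁ - 2)) := by
  have hA' : (A₀ + A₁ - 2 : ℝ) ≠ 0 := by
    rw [sub_ne_zero]; exact_mod_cast hA
  induction j with
  | zero => simp [descendantSum]
  | succ j ih =>
    rw [hf.descendantSum_succ hm]
    push_cast
    rw [ih]
    field_simp
    ring

theorem descendantSum_eq_of_add_eq_two (hf : IsAffineTwoRegular A₀ A₁ b₀ b₁ f) {m : ℕ}
    (hm : 1 ≤ m) (hA : A₀ + A₁ = 2) (j : ℕ) :
    (descendantSum f j m : ℝ) = 2 ^ j * (f m + (b₀ + b₁) * j / 2) := by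
  induction j with
  | zero => simp [descendantSum]
  | succ j ih =>
    rw [hf.descendantSum_succ hm, hA]
    push_cast
    rw [ih]
    ring

theorem descendantSum_eq_of_homogeneous (hf : IsAffineTwoRegular A₀ A₁ 0 0 f) {m : ℕ}
    (hm : 1 ≤ m) (j : ℕ) :
    (descendantSum f j m : ℝ) = (A₀ + A₁ : ℝ) ^ j * f m := by
  induction j with
  | zero => simp [descendantSum]
  | succ j ih =>
    rw [hf.descendantSum_succ hm]
    push_cast
    rw [ih]
    ring

theorem tendsto_descendantSum_div_pow (hf : IsAffineTwoRegular A₀ A₁ b₀ b₁ f) {m : ℕ} (hm : 1 ≤ m)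
    (hA : 0 < A₀ + A₁) (hAB : b₀ + b₁ = 0 ∨ 2 < A₀ + A₁) :
    Tendsto (fun j => (descendantSum f j m : ℝ) / (A₀ + A₁ : ℝ) ^ j) atTop
      (𝓝 (f m + (b₀ + b₁ : ℝ) / (A₀ + A₁ - 2))) := by
  have hA0 : (0 : ℝ) < A₀ + A₁ := by exact_mod_cast hA
  rcases hAB with hB | hA2
  · obtain ⟨rfl, rfl⟩ : b₀ = 0 ∧ b₁ = 0 := by omega
    simp only [hf.descendantSum_eq_of_homogeneous hm]
    -- The fraction has numerator zero, so it vanishes even when `A₀ + A₁ = 2`.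
    simp [hA0.ne']
  · have hA2' : (2 : ℝ) < A₀ + A₁ := by exact_mod_cast hA2
    have h : ∀ j, (descendantSum f j m : ℝ) / (A₀ + A₁ : ℝ) ^ j =
        (f m + (b₀ + b₁ : ℝ) / (A₀ + A₁ - 2)) -
          (2 / (A₀ + A₁ : ℝ)) ^ j * ((b₀ + b₁ : ℝ) / (A₀ + A₁ - 2)) := fun j => by
      rw [hf.descendantSum_eq hm (by omega), div_pow]
      field_simp
    simp only [h]
    have := tendsto_pow_atTop_nhds_zero_of_lt_one (r := 2 / (A₀ + A₁ : ℝ)) (by positivity)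
      ((div_lt_one hA0).2 hA2')
    simpa using (this.mul_const ((b₀ + b₁ : ℝ) / (A₀ + A₁ - 2))).const_sub
      (f m + (b₀ + b₁ : ℝ) / (A₀ + A₁ - 2))

/-- The inhomogeneous term dominates and the limit forgets `m`. -/
theorem tendsto_descendantSum_div_two_pow (hf : IsAffineTwoRegular A₀ A₁ b₀ b₁ f) {m : ℕ}
    (hm : 1 ≤ m) (hA : A₀ + A₁ < 2) :
    Tendsto (fun j => (descendantSum f j m : ℝ) / 2 ^ j) atTop
      (𝓝 ((b₀ + b₁ : ℝ) / (2 - (A₀ + A₁)))) := by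
  have hA2' : (A₀ + A₁ : ℝ) < 2 := by exact_mod_cast hA
  have h : ∀ j, (descendantSum f j m : ℝ) / 2 ^ j =
      ((A₀ + A₁ : ℝ) / 2) ^ j * (f m + (b₀ + b₁ : ℝ) / (A₀ + A₁ - 2)) -
        ((b₀ + b₁ : ℝ) / (A₀ + A₁ - 2)) := fun j => by
    rw [hf.descendantSum_eq hm (by omega), div_pow]
    field_simp
  simp only [h]
  have := tendsto_pow_atTop_nhds_zero_of_lt_one (r := (A₀ + A₁ : ℝ) / 2) (by positivity)
    (by linarith)
  convert! (this.mul_const (f m + (b₀ + b₁ : ℝ) / (A₀ + A₁ - 2))).sub_const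
      ((b₀ + b₁ : ℝ) / (A₀ + A₁ - 2)) using 2
  rw [zero_mul, zero_sub, ← div_neg, neg_sub]

theorem tendsto_descendantSum_div_mul_two_pow (hf : IsAffineTwoRegular A₀ A₁ b₀ b₁ f) {m : ℕ}
    (hm : 1 ≤ m) (hA : A₀ + A₁ = 2) :
    Tendsto (fun j => (descendantSum f j m : ℝ) / (j * 2 ^ j)) atTop
      (𝓝 ((b₀ + b₁ : ℝ) / 2)) := by
  have h : ∀ᶠ j : ℕ in atTop, (f m : ℝ) / j + (b₀ + b₁ : ℝ) / 2 =
      (descendantSum f j m : ℝ) / (j * 2 ^ j) := by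
    filter_upwards [eventually_gt_atTop 0] with j hj
    rw [hf.descendantSum_eq_of_add_eq_two hm hA]
    have : (j : ℝ) ≠ 0 := by exact_mod_cast hj.ne'
    field_simp
  refine Tendsto.congr' h ?_
  simpa using (tendsto_const_div_atTop_nhds_zero_nat (f m : ℝ)).add_const ((b₀ + b₁ : ℝ) / 2)

end IsAffineTwoRegular

/-! ### Lebesgue measure on the unit interval -/

theorem map_dyadicBranch_one_volume (d : ℕ) :
    (volume : Measure ℝ).map (dyadicBranch 1 d) = (2 : ℝ≥0∞) • volume := by
  have : dyadicBranch 1 d = (fun x : ℝ => x * 2⁻¹) ∘ (fun x : ℝ => x + d) := by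
    ext x; simp [dyadicBranch, div_eq_mul_inv]
  rw [this, ← Measure.map_map (by fun_prop) (by fun_prop), map_add_right_eq_self,
    Real.map_volume_mul_right (by norm_num)]
  norm_num

/-- Lebesgue measure on the unit interval. -/
noncomputable def unitLebesgue : Measure ℝ := volume.restrict (Set.Ioc 0 1)

theorem unitLebesgue_univ : unitLebesgue Set.univ = 1 := by simp [unitLebesgue]

instance : IsProbabilityMeasure unitLebesgue := ⟨unitLebesgue_univ⟩

theorem unitLebesgue_compl_Icc : unitLebesgue (Set.Icc 0 1)ᶜ = 0 := by
  rw [unitLebesgue, Measure.restrict_apply measurableSet_Icc.compl]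
  have : (Set.Icc (0 : ℝ) 1)ᶜ ∩ Set.Ioc 0 1 = ∅ := by
    ext x; simp only [Set.mem_inter_iff, Set.mem_compl_iff, Set.mem_Icc, Set.mem_Ioc]
    grind
  simp [this]

theorem unitLebesgue_eq : unitLebesgue = (2 : ℝ≥0∞)⁻¹ •
    (unitLebesgue.map (dyadicBranch 1 0) + unitLebesgue.map (dyadicBranch 1 1)) := by
  have h0 : dyadicBranch 1 0 ⁻¹' (Set.Ioc 0 (1 / 2)) = Set.Ioc 0 1 := by
    ext x; simp only [Set.mem_preimage, dyadicBranch, Set.mem_Ioc]; norm_num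
    grind
  have h1 : dyadicBranch 1 1 ⁻¹' (Set.Ioc (1 / 2) 1) = Set.Ioc 0 1 := by
    ext x; simp only [Set.mem_preimage, dyadicBranch, Set.mem_Ioc]; norm_num
    grind
  have e0 : unitLebesgue.map (dyadicBranch 1 0) =
      (2 : ℝ≥0∞) • (volume.restrict (Set.Ioc (0 : ℝ) (1 / 2))) := by
    rw [unitLebesgue, ← h0, ← Measure.restrict_map (measurable_dyadicBranch _ _) measurableSet_Ioc,
      map_dyadicBranch_one_volume, Measure.restrict_smul]
  have e1 : unitLebesgue.map (dyadicBranch 1 1) =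
      (2 : ℝ≥0∞) • (volume.restrict (Set.Ioc (1 / 2 : ℝ) 1)) := by
    rw [unitLebesgue, ← h1, ← Measure.restrict_map (measurable_dyadicBranch _ _) measurableSet_Ioc,
      map_dyadicBranch_one_volume, Measure.restrict_smul]
  -- Half-open halves are disjoint, so no endpoint has to be discarded.
  rw [e0, e1, ← smul_add, smul_smul, ENNReal.inv_mul_cancel (by norm_num) (by norm_num), one_smul,
    ← Measure.restrict_union (by simp) measurableSet_Ioc,
    Set.Ioc_union_Ioc_eq_Ioc (by norm_num) (by norm_num), unitLebesgue]

theorem normalizedPush_unitLebesgue : normalizedPush unitLebesgue = volume := by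
  rw [normalizedPush, unitLebesgue_univ, inv_one, one_smul, unitLebesgue]
  simpa using (AddCircle.measurePreserving_mk (1 : ℝ) 0).map_eq

theorem isDyadicFamily_unitLebesgue : IsDyadicFamily (2 : ℝ≥0∞)⁻¹ (fun _ => unitLebesgue) where
  finite := fun _ => inferInstance
  compl_Icc := fun _ => unitLebesgue_compl_Icc
  split := fun _ _ => unitLebesgue_eq

/-- All nodes of a level have the same asymptotic weight, so the constant Lebesgue family applies;
the constant factor in `c` makes its masses equal to 1. -/
theorem IsAffineTwoRegular.isGhostMeasure_volume {A₀ A₁ b₀ b₁ : ℕ} {f : ℕ → ℕ}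
    (hf : IsAffineTwoRegular A₀ A₁ b₀ b₁ f) (hB : b₀ + b₁ ≠ 0) (hA : A₀ + A₁ ≤ 2) :
    IsGhostMeasure f volume := by
  rw [← normalizedPush_unitLebesgue]
  have hB' : (0 : ℝ) < b₀ + b₁ := by exact_mod_cast Nat.pos_of_ne_zero hB
  have h1 : unitLebesgue ≠ 0 := IsProbabilityMeasure.ne_zero _
  have hone : (unitLebesgue.real Set.univ) = 1 := by simp
  rcases hA.lt_or_eq with hA | hA
  · have hA' : (0 : ℝ) < 2 - (A₀ + A₁) := by rw [sub_pos]; exact_mod_cast hA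
    have hC : 0 < (b₀ + b₁ : ℝ) / (2 - (A₀ + A₁)) := by positivity
    refine isDyadicFamily_unitLebesgue.isGhostMeasure h1
      (c := fun j => 2 ^ j * ((b₀ + b₁ : ℝ) / (2 - (A₀ + A₁))))
      (Eventually.of_forall fun j => by positivity) (fun k => ?_) (fun m hm => ?_)
    · refine tendsto_const_nhds.congr fun j => ?_
      simp only [ENNReal.toReal_pow, ENNReal.toReal_inv, ENNReal.toReal_ofNat]
      rw [pow_add]; field_simp
      simp
    · rw [hone]
      have := (hf.tendsto_descendantSum_div_two_pow hm hA).div_const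
        ((b₀ + b₁ : ℝ) / (2 - (A₀ + A₁)))
      rw [div_self hC.ne'] at this
      simpa only [div_div] using this
  -- In the resonant case `c j / c (j + k)` is `j / (j + k)` times `2⁻ᵏ`; positivity is only
  -- eventual because `c 0 = 0`.
  · refine isDyadicFamily_unitLebesgue.isGhostMeasure h1
      (c := fun j => j * 2 ^ j * ((b₀ + b₁ : ℝ) / 2)) ?_ (fun k => ?_) (fun m hm => ?_)
    · filter_upwards [eventually_gt_atTop 0] with j hj
      have : (0 : ℝ) < j := by exact_mod_cast hj
      positivity
    · have h := (tendsto_natCast_div_add_atTop (𝕜 := ℝ) (k : ℝ)).mul_const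
        (((2 : ℝ≥0∞)⁻¹ ^ k).toReal)
      rw [one_mul] at h
      refine h.congr fun j => ?_
      simp only [ENNReal.toReal_pow, ENNReal.toReal_inv, ENNReal.toReal_ofNat]
      push_cast
      rw [pow_add, inv_pow]; field_simp
    · rw [hone]
      have := (hf.tendsto_descendantSum_div_mul_two_pow hm hA).div_const ((b₀ + b₁ : ℝ) / 2)
      rw [div_self (by positivity)] at this
      simpa only [div_div] using this

/-! ### Self-similar measures with source terms -/

/-- A probability measure on the unit interval that is stationary for the random dyadic
contraction choosing the left half with probability `p` and the right half with probability `q`. -/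
structure IsBinarySelfSimilar (p q : ℝ≥0∞) (β : Measure ℝ) : Prop where
  isProbabilityMeasure : IsProbabilityMeasure β
  compl_Icc : β (Set.Icc 0 1)ᶜ = 0
  eq_add : β = p • β.map (dyadicBranch 1 0) + q • β.map (dyadicBranch 1 1)

/-- The sum of the copies of `ν` on the two halves of the unit interval, scaled by `α`. -/
noncomputable def subdivide (α : ℝ≥0∞) (ν : Measure ℝ) : Measure ℝ :=
  α • (ν.map (dyadicBranch 1 0) + ν.map (dyadicBranch 1 1))

/-- The source term: copies of `β` on the two halves with weights proportional to `b₀, b₁`. -/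
noncomputable def sourceTerm (α : ℝ≥0∞) (b₀ b₁ : ℕ) (β : Measure ℝ) : Measure ℝ :=
  α • ((b₀ : ℝ≥0∞) • β.map (dyadicBranch 1 0) + (b₁ : ℝ≥0∞) • β.map (dyadicBranch 1 1))

/-- The superposition of the source terms injected at all nodes of the binary tree. -/
noncomputable def sourceSum (α : ℝ≥0∞) (b₀ b₁ : ℕ) (β : Measure ℝ) : Measure ℝ :=
  Measure.sum fun j => (subdivide α)^[j] (sourceTerm α b₀ b₁ β)

theorem subdivide_apply (α : ℝ≥0∞) (ν : Measure ℝ) {s : Set ℝ} (hs : MeasurableSet s) :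
    subdivide α ν s = α * (ν (dyadicBranch 1 0 ⁻¹' s) + ν (dyadicBranch 1 1 ⁻¹' s)) := by
  simp [subdivide, Measure.map_apply (measurable_dyadicBranch _ _) hs, mul_add]

theorem sourceTerm_apply (α : ℝ≥0∞) (b₀ b₁ : ℕ) (β : Measure ℝ) {s : Set ℝ}
    (hs : MeasurableSet s) : sourceTerm α b₀ b₁ β s =
      α * (b₀ * β (dyadicBranch 1 0 ⁻¹' s) + b₁ * β (dyadicBranch 1 1 ⁻¹' s)) := by
  simp [sourceTerm, Measure.map_apply (measurable_dyadicBranch _ _) hs, mul_add]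

/-- Splitting off the term `j = 0` of the series leaves its image under `subdivide`; in `ℝ≥0∞` no
convergence is needed. -/
theorem sourceSum_eq (α : ℝ≥0∞) (b₀ b₁ : ℕ) (β : Measure ℝ) :
    sourceSum α b₀ b₁ β = sourceTerm α b₀ b₁ β + subdivide α (sourceSum α b₀ b₁ β) := by
  ext s hs
  have hs' : ∀ d, MeasurableSet (dyadicBranch 1 d ⁻¹' s) := fun d => measurable_dyadicBranch _ _ hs
  rw [Measure.add_apply, subdivide_apply _ _ hs, sourceSum, Measure.sum_apply _ hs,
    Measure.sum_apply _ (hs' 0), Measure.sum_apply _ (hs' 1), tsum_eq_zero_add' ENNReal.summable,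
    ← ENNReal.tsum_add, ← ENNReal.tsum_mul_left]
  simp only [Function.iterate_succ_apply', subdivide_apply _ _ hs, Function.iterate_zero, id]

theorem preimage_dyadicBranch_compl_Icc_subset {k d : ℕ} (hd : d < 2 ^ k) :
    dyadicBranch k d ⁻¹' (Set.Icc 0 1)ᶜ ⊆ (Set.Icc 0 1)ᶜ := fun _ hx hx' =>
  hx (dyadicBranch_mem_Icc hd hx')

/-- Any property stable under the operations that build a node measure passes from `β` to it. This
transfers both the support condition and the Lebesgue type. -/
theorem induction_sourceSum {Q : Measure ℝ → Prop}
    (hsmul : ∀ (c : ℝ≥0∞) μ, Q μ → Q (c • μ)) (hadd : ∀ μ ν, Q μ → Q ν → Q (μ + ν))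
    (hsum : ∀ μ : ℕ → Measure ℝ, (∀ j, Q (μ j)) → Q (Measure.sum μ))
    (hmap : ∀ d < 2, ∀ μ, Q μ → Q (μ.map (dyadicBranch 1 d)))
    {β : Measure ℝ} (hβ : Q β) (a α : ℝ≥0∞) (b₀ b₁ : ℕ) :
    Q (a • β + sourceSum α b₀ b₁ β) := by
  refine hadd _ _ (hsmul _ _ hβ) (hsum _ fun j => ?_)
  induction j with
  | zero =>
    exact hsmul _ _ (hadd _ _ (hsmul _ _ (hmap 0 (by norm_num) _ hβ))
      (hsmul _ _ (hmap 1 (by norm_num) _ hβ)))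
  | succ j ih =>
    rw [Function.iterate_succ_apply']
    exact hsmul _ _ (hadd _ _ (hmap 0 (by norm_num) _ ih) (hmap 1 (by norm_num) _ ih))

theorem sourceSum_zero (α : ℝ≥0∞) (β : Measure ℝ) : sourceSum α 0 0 β = 0 := by
  have h : ∀ j, (subdivide α)^[j] (sourceTerm α 0 0 β) = 0 := fun j => by
    induction j with
    | zero => simp [sourceTerm]
    | succ j ih => rw [Function.iterate_succ_apply', ih]; simp [subdivide]
  ext s hs
  simp [sourceSum, h]

/-- Subdividing multiplies total mass by `2 * α`, so the masses form a geometric series. -/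
theorem sourceSum_univ {α : ℝ≥0∞} {b₀ b₁ : ℕ} {β : Measure ℝ} [IsProbabilityMeasure β] :
    sourceSum α b₀ b₁ β Set.univ = (1 - 2 * α)⁻¹ * (α * (b₀ + b₁)) := by
  have h : ∀ j, (subdivide α)^[j] (sourceTerm α b₀ b₁ β) Set.univ =
      (2 * α) ^ j * (α * (b₀ + b₁)) := fun j => by
    induction j with
    | zero => simp [sourceTerm_apply]
    | succ j ih =>
      rw [Function.iterate_succ_apply', subdivide_apply _ _ MeasurableSet.univ]
      simp only [Set.preimage_univ, ih]
      ring
  rw [sourceSum, Measure.sum_apply _ MeasurableSet.univ]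
  simp only [h, ENNReal.tsum_mul_right, ENNReal.tsum_geometric]

theorem sourceSum_univ_inv {A b₀ b₁ : ℕ} {β : Measure ℝ} [IsProbabilityMeasure β]
    (hAB : b₀ + b₁ = 0 ∨ 2 < A) : sourceSum (A : ℝ≥0∞)⁻¹ b₀ b₁ β Set.univ =
      ENNReal.ofReal ((b₀ + b₁ : ℝ) / (A - 2)) := by
  rcases hAB with hB | hA
  · obtain ⟨rfl, rfl⟩ : b₀ = 0 ∧ b₁ = 0 := by omega
    simp [sourceSum_zero]
  · have hA' : (2 : ℝ) < A := by exact_mod_cast hA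
    have hA0 : (0 : ℝ) < A := by linarith
    have e : (A : ℝ≥0∞)⁻¹ = ENNReal.ofReal ((A : ℝ)⁻¹) := by
      rw [ENNReal.ofReal_inv_of_pos hA0, ENNReal.ofReal_natCast]
    have e2 : (2 : ℝ≥0∞) = ENNReal.ofReal 2 := by simp
    have e3 : (b₀ + b₁ : ℝ≥0∞) = ENNReal.ofReal (b₀ + b₁) := by
      rw [ENNReal.ofReal_add (by positivity) (by positivity)]; simp
    have h2 : 0 < 1 - 2 * (A : ℝ)⁻¹ := by
      rw [← div_eq_mul_inv, sub_pos, div_lt_one hA0]; exact hA'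
    rw [sourceSum_univ, e, e2, e3, ← ENNReal.ofReal_mul (by norm_num), ← ENNReal.ofReal_one,
      ← ENNReal.ofReal_sub _ (by positivity), ← ENNReal.ofReal_inv_of_pos h2,
      ← ENNReal.ofReal_mul (by positivity), ← ENNReal.ofReal_mul (by positivity)]
    congr 1
    have : (A : ℝ) - 2 ≠ 0 := by linarith
    field_simp

/-- The unnormalised measure attached to the node `m` of the binary tree. -/
noncomputable def nodeMeasure (α : ℝ≥0∞) (b₀ b₁ : ℕ) (f : ℕ → ℕ) (β : Measure ℝ) (m : ℕ) :
    Measure ℝ :=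
  (f m : ℝ≥0∞) • β + sourceSum α b₀ b₁ β

namespace IsAffineTwoRegular

variable {A₀ A₁ b₀ b₁ : ℕ} {f : ℕ → ℕ} {β : Measure ℝ}

theorem nodeMeasure_univ (hAB : b₀ + b₁ = 0 ∨ 2 < A₀ + A₁) [IsProbabilityMeasure β] (m : ℕ) :
    nodeMeasure ((A₀ + A₁ : ℕ) : ℝ≥0∞)⁻¹ b₀ b₁ f β m Set.univ =
      ENNReal.ofReal (f m + (b₀ + b₁ : ℝ) / (A₀ + A₁ - 2)) := by
  have h : 0 ≤ (b₀ + b₁ : ℝ) / (A₀ + A₁ - 2) := by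
    rcases hAB with hB | hA
    · obtain ⟨rfl, rfl⟩ : b₀ = 0 ∧ b₁ = 0 := by omega
      simp
    · have : (2 : ℝ) < A₀ + A₁ := by exact_mod_cast hA
      have : (0 : ℝ) < A₀ + A₁ - 2 := by linarith
      positivity
  rw [ENNReal.ofReal_add (by positivity) h, nodeMeasure, Measure.add_apply,
    sourceSum_univ_inv hAB]
  simp

/-- In the children's measures the parts `A₀ f(m), A₁ f(m)` reassemble `f(m) β` by self-similarity,
the parts `b₀, b₁` give the source term, and the two copies of `sourceSum` give its subdivision. -/
theorem isDyadicFamily_nodeMeasure (hf : IsAffineTwoRegular A₀ A₁ b₀ b₁ f) {α p q : ℝ≥0∞}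
    (hβ : IsBinarySelfSimilar p q β) (hα : α = ((A₀ + A₁ : ℕ) : ℝ≥0∞)⁻¹)
    (hp : α * A₀ = p) (hq : α * A₁ = q) (hAB : b₀ + b₁ = 0 ∨ 2 < A₀ + A₁) :
    IsDyadicFamily α (nodeMeasure α b₀ b₁ f β) where
  finite := fun m => by
    have := hβ.isProbabilityMeasure
    exact ⟨by rw [hα, nodeMeasure_univ hAB]; exact ENNReal.ofReal_lt_top⟩
  compl_Icc := fun m => by
    refine induction_sourceSum (Q := fun μ => μ (Set.Icc 0 1)ᶜ = 0) ?_ ?_ ?_ ?_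
      hβ.compl_Icc _ _ _ _
    · intro c μ h; simp [h]
    · intro μ ν h h'; simp [h, h']
    · intro μ h; simp [Measure.sum_apply _ measurableSet_Icc.compl, h]
    · intro d hd μ h
      rw [Measure.map_apply (measurable_dyadicBranch _ _) measurableSet_Icc.compl]
      exact measure_mono_null (preimage_dyadicBranch_compl_Icc_subset (by simpa using hd)) h
  split := fun m hm => by
    obtain ⟨h0, h1⟩ := hf m hm
    have hS := sourceSum_eq α b₀ b₁ β
    have hB := hβ.eq_add
    ext s hs
    have hs' : ∀ d, MeasurableSet (dyadicBranch 1 d ⁻¹' s) := fun d =>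
      measurable_dyadicBranch _ _ hs
    have hS' : sourceSum α b₀ b₁ β s = _ := congrArg (fun μ : Measure ℝ => μ s) hS
    have hB' : β s = _ := congrArg (fun μ : Measure ℝ => μ s) hB
    simp only [Measure.add_apply, subdivide_apply _ _ hs, sourceTerm_apply _ _ _ _ hs,
      Measure.smul_apply, smul_eq_mul, Measure.map_apply (measurable_dyadicBranch _ _) hs,
      ← hp, ← hq] at hS' hB'
    simp only [nodeMeasure, Measure.add_apply, Measure.smul_apply, smul_eq_mul,
      Measure.map_apply (measurable_dyadicBranch _ _) hs]
    rw [hS', hB', h0, h1]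
    push_cast
    ring

theorem isGhostMeasure_nodeMeasure (hf : IsAffineTwoRegular A₀ A₁ b₀ b₁ f) {α p q : ℝ≥0∞}
    (hβ : IsBinarySelfSimilar p q β) (hA : 0 < A₀ + A₁) (hα : α = ((A₀ + A₁ : ℕ) : ℝ≥0∞)⁻¹)
    (hp : α * A₀ = p) (hq : α * A₁ = q)
    (hAB : (b₀ + b₁ = 0 ∧ f 1 ≠ 0) ∨ (b₀ + b₁ ≠ 0 ∧ 2 < A₀ + A₁)) :
    IsGhostMeasure f (normalizedPush (nodeMeasure α b₀ b₁ f β 1)) ∧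
      IsProbabilityMeasure (normalizedPush (nodeMeasure α b₀ b₁ f β 1)) := by
  have := hβ.isProbabilityMeasure
  have hAB' : b₀ + b₁ = 0 ∨ 2 < A₀ + A₁ := hAB.imp (·.1) (·.2)
  have hA0 : (0 : ℝ) < A₀ + A₁ := by exact_mod_cast hA
  have hfam := hf.isDyadicFamily_nodeMeasure hβ hα hp hq hAB'
  have hfin := hfam.finite
  have hweight : 0 ≤ (b₀ + b₁ : ℝ) / (A₀ + A₁ - 2) ∧
      0 < (f 1 : ℝ) + (b₀ + b₁ : ℝ) / (A₀ + A₁ - 2) := by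
    rcases hAB with ⟨hB, h1⟩ | ⟨hB, h2⟩
    · obtain ⟨rfl, rfl⟩ : b₀ = 0 ∧ b₁ = 0 := by omega
      simpa using Nat.pos_of_ne_zero h1
    · have : (2 : ℝ) < A₀ + A₁ := by exact_mod_cast h2
      have : (0 : ℝ) < A₀ + A₁ - 2 := by linarith
      have hB' : (0 : ℝ) < b₀ + b₁ := by exact_mod_cast Nat.pos_of_ne_zero hB
      constructor <;> positivity
  have hne : nodeMeasure α b₀ b₁ f β 1 ≠ 0 := by
    intro h
    have h' := nodeMeasure_univ (f := f) (β := β) hAB' 1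
    rw [← hα, h] at h'
    simp only [Measure.coe_zero, Pi.zero_apply, eq_comm (a := (0 : ℝ≥0∞)),
      ENNReal.ofReal_eq_zero] at h'
    linarith [hweight.2]
  have : NeZero (nodeMeasure α b₀ b₁ f β 1) := ⟨hne⟩
  refine ⟨hfam.isGhostMeasure hne (c := fun j => (A₀ + A₁ : ℝ) ^ j)
    (Eventually.of_forall fun j => by positivity) (fun k => ?_) (fun m hm => ?_),
    isProbabilityMeasure_normalizedPush⟩
  · refine tendsto_const_nhds.congr fun j => ?_
    rw [hα, ENNReal.toReal_pow, ENNReal.toReal_inv, ENNReal.toReal_natCast]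
    push_cast
    rw [pow_add, inv_pow]
    field_simp
  · rw [measureReal_def, hα, nodeMeasure_univ hAB', ENNReal.toReal_ofReal
      (add_nonneg (Nat.cast_nonneg _) hweight.1)]
    exact hf.tendsto_descendantSum_div_pow hm hA hAB'

end IsAffineTwoRegular

theorem normalizedPush_nodeMeasure_of_homogeneous {α : ℝ≥0∞} {f : ℕ → ℕ} {β : Measure ℝ}
    [IsProbabilityMeasure β] {m : ℕ} (h : f m ≠ 0) :
    normalizedPush (nodeMeasure α 0 0 f β m) = normalizedPush β := by
  have h' : (f m : ℝ≥0∞) ≠ 0 := by exact_mod_cast h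
  simp [normalizedPush, nodeMeasure, sourceSum_zero, smul_smul,
    ENNReal.inv_mul_cancel h' (ENNReal.natCast_ne_top _)]

/-! ### Bernoulli measures on the unit interval -/

/-- The sequence with first term `x.1` and tail `x.2`. -/
def consSeq {X : Type*} (x : X × (ℕ → X)) : ℕ → X
  | 0 => x.1
  | n + 1 => x.2 n

theorem measurable_consSeq {X : Type*} [MeasurableSpace X] :
    Measurable (consSeq : X × (ℕ → X) → ℕ → X) := by
  refine measurable_pi_iff.2 fun n => ?_
  cases n with
  | zero => exact measurable_fst
  | succ n => exact (measurable_pi_apply n).comp measurable_snd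

/-- Prepending an independent letter preserves the i.i.d. law. On cylinders, the constraint at index
0 separates from the shifted constraints on the tail. -/
theorem map_consSeq_infinitePi {X : Type*} [MeasurableSpace X] (ν : Measure X)
    [IsProbabilityMeasure ν] :
    (ν.prod (Measure.infinitePi fun _ : ℕ => ν)).map consSeq =
      Measure.infinitePi fun _ : ℕ => ν := by
  classical
  refine Measure.eq_infinitePi _ fun s t ht => ?_
  rw [Measure.map_apply measurable_consSeq
    (MeasurableSet.pi s.countable_toSet fun i _ => ht i)]
  set s' := s.preimage Nat.succ Nat.succ_injective.injOn
  have hpre : consSeq ⁻¹' (Set.pi (s : Set ℕ) t) =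
      (if 0 ∈ s then t 0 else Set.univ) ×ˢ Set.pi (s' : Set ℕ) (fun n => t (n + 1)) := by
    ext x
    simp only [Set.mem_preimage, Set.mem_pi, Set.mem_prod, s', Finset.coe_preimage]
    constructor
    · intro h
      refine ⟨?_, fun n hn => h (n + 1) hn⟩
      split_ifs with h0
      · exact h 0 h0
      · trivial
    · rintro ⟨h0, h1⟩ n hn
      cases n with
      | zero => rw [if_pos (by exact_mod_cast hn)] at h0; exact h0
      | succ n => exact h1 n hn
  rw [hpre, Measure.prod_prod, Measure.infinitePi_pi _ (fun i _ => ht _)]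
  have hprod := Finset.prod_preimage' Nat.succ s Nat.succ_injective.injOn (fun n => ν (t n))
  rw [hprod, ← Finset.prod_filter_mul_prod_filter_not s (fun x => x ∈ Set.range Nat.succ), mul_comm]
  congr 1
  split_ifs with h0
  · have : s.filter (fun x => x ∉ Set.range Nat.succ) = {0} := by
      ext n
      cases n <;> simp [h0]
    rw [this, Finset.prod_singleton]
  · have : s.filter (fun x => x ∉ Set.range Nat.succ) = ∅ := by
      ext n
      cases n <;> simp [h0]
    rw [this, Finset.prod_empty, measure_univ]

/-- The law of a biased bit. -/
noncomputable def bitMeasure (p q : ℝ≥0∞) : Measure (Fin 2) :=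
  p • Measure.dirac 0 + q • Measure.dirac 1

theorem isProbabilityMeasure_bitMeasure {p q : ℝ≥0∞} (h : p + q = 1) :
    IsProbabilityMeasure (bitMeasure p q) := ⟨by simp [bitMeasure, h]⟩

/-- The law of a sequence of independent biased bits. -/
noncomputable def bitSequenceMeasure (p q : ℝ≥0∞) : Measure (ℕ → Fin 2) :=
  Measure.infinitePi fun _ => bitMeasure p q

/-- The law of a random number with independent biased binary digits. -/
noncomputable def bernoulliMeasure (p q : ℝ≥0∞) : Measure ℝ :=
  (bitSequenceMeasure p q).map Real.ofDigits

theorem measurable_ofDigits_two : Measurable (Real.ofDigits : (ℕ → Fin 2) → ℝ) :=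
  Real.continuous_ofDigits.measurable

theorem ofDigits_eq_dyadicBranch (ω : ℕ → Fin 2) :
    Real.ofDigits ω = dyadicBranch 1 (ω 0 : ℕ) (Real.ofDigits fun i => ω (i + 1)) := by
  rw [Real.ofDigits_eq_sum_add_ofDigits ω 1]
  simp [Real.ofDigitsTerm, dyadicBranch]
  ring

theorem map_dirac_prod {X Y Z : Type*} [MeasurableSpace X] [MeasurableSpace Y] [MeasurableSpace Z]
    {P : Measure Y} [SFinite P] {F : X × Y → Z} (hF : Measurable F) (x : X) :
    ((Measure.dirac x).prod P).map F = P.map (fun y => F (x, y)) := by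
  rw [Measure.dirac_prod, Measure.map_map hF measurable_prodMk_left]
  rfl

section Bernoulli

variable {p q : ℝ≥0∞}

theorem isProbabilityMeasure_bitSequenceMeasure (h : p + q = 1) :
    IsProbabilityMeasure (bitSequenceMeasure p q) := by
  have := isProbabilityMeasure_bitMeasure h
  unfold bitSequenceMeasure
  infer_instance

/-- Condition on the first digit, which selects the half; the tail is independent with the same law.
-/
theorem isBinarySelfSimilar_bernoulliMeasure (h : p + q = 1) :
    IsBinarySelfSimilar p q (bernoulliMeasure p q) := by
  have := isProbabilityMeasure_bitMeasure h
  have hP := isProbabilityMeasure_bitSequenceMeasure h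
  refine ⟨Measure.isProbabilityMeasure_map measurable_ofDigits_two.aemeasurable, ?_, ?_⟩
  · rw [bernoulliMeasure, Measure.map_apply measurable_ofDigits_two measurableSet_Icc.compl]
    have : (Real.ofDigits ⁻¹' (Set.Icc 0 1)ᶜ : Set (ℕ → Fin 2)) = ∅ := by
      ext ω
      simp [Real.ofDigits_nonneg, Real.ofDigits_le_one]
    rw [this, measure_empty]
  · have hF : (Real.ofDigits ∘ consSeq : Fin 2 × (ℕ → Fin 2) → ℝ) =
        fun x => dyadicBranch 1 (x.1 : ℕ) (Real.ofDigits x.2) := by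
      ext x
      rw [Function.comp, ofDigits_eq_dyadicBranch]
      rfl
    have hm : Measurable (fun x : Fin 2 × (ℕ → Fin 2) =>
        dyadicBranch 1 (x.1 : ℕ) (Real.ofDigits x.2)) := by
      rw [← hF]; exact measurable_ofDigits_two.comp measurable_consSeq
    conv_lhs => rw [bernoulliMeasure, bitSequenceMeasure, ← map_consSeq_infinitePi,
      Measure.map_map measurable_ofDigits_two measurable_consSeq, hF]
    change Measure.map _ ((bitMeasure p q).prod (bitSequenceMeasure p q)) = _
    rw [bitMeasure, Measure.add_prod, Measure.prod_smul_left, Measure.prod_smul_left,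
      Measure.map_add _ _ hm, Measure.map_smul, Measure.map_smul, map_dirac_prod hm,
      map_dirac_prod hm, bernoulliMeasure,
      Measure.map_map (measurable_dyadicBranch _ _) measurable_ofDigits_two,
      Measure.map_map (measurable_dyadicBranch _ _) measurable_ofDigits_two]
    rfl

end Bernoulli

namespace IsBinarySelfSimilar

variable {p q : ℝ≥0∞} {β : Measure ℝ}

theorem apply_singleton (hβ : IsBinarySelfSimilar p q β) (x : ℝ) :
    β {x} = p * β {2 * x} + q * β {2 * x - 1} := by
  have e0 : dyadicBranch 1 0 ⁻¹' {x} = {2 * x} := by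
    ext y; simp [dyadicBranch]; grind
  have e1 : dyadicBranch 1 1 ⁻¹' {x} = {2 * x - 1} := by
    ext y; simp [dyadicBranch]; grind
  have h := congrArg (fun μ : Measure ℝ => μ {x}) hβ.eq_add
  simpa [Measure.map_apply (measurable_dyadicBranch _ _) (measurableSet_singleton x), e0, e1] using h

theorem apply_singleton_of_notMem (hβ : IsBinarySelfSimilar p q β) {x : ℝ}
    (hx : x ∉ Set.Icc (0 : ℝ) 1) : β {x} = 0 :=
  measure_mono_null (by simpa using hx) hβ.compl_Icc

/-- The endpoints are fixed points of the branches, so their masses satisfy `a = r * a` with `r <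
1`. Any other atom would be at most `max p q` times an earlier one, since at most one preimage
carries mass; iterate. -/
theorem noAtoms (hβ : IsBinarySelfSimilar p q β) (hp : p < 1) (hq : q < 1) (x : ℝ) :
    β {x} = 0 := by
  have := hβ.isProbabilityMeasure
  have hzero : ∀ {a r : ℝ≥0∞}, r < 1 → a ≠ ∞ → a = r * a → a = 0 := by
    intro a r hr ha h
    by_contra h0
    have : r * a < 1 * a := ENNReal.mul_lt_mul_left h0 ha hr
    rw [← h, one_mul] at this
    exact lt_irrefl _ this
  have h0 : β {0} = 0 := by
    refine hzero hp (measure_ne_top _ _) ?_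
    have := hβ.apply_singleton 0
    rwa [hβ.apply_singleton_of_notMem (x := 2 * 0 - 1) (by norm_num), mul_zero (2 : ℝ), mul_zero,
      add_zero] at this
  have h1 : β {1} = 0 := by
    refine hzero hq (measure_ne_top _ _) ?_
    have := hβ.apply_singleton 1
    rw [hβ.apply_singleton_of_notMem (x := 2 * 1) (by norm_num), mul_zero, zero_add] at this
    norm_num at this
    exact this
  have hk : ∀ (k : ℕ) (x : ℝ), β {x} ≤ (max p q) ^ k := by
    intro k
    induction k with
    | zero => intro x; simpa using prob_le_one
    | succ k ih =>
      intro x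
      rw [hβ.apply_singleton x, pow_succ']
      rcases lt_or_ge x (1 / 2) with hx | hx
      · rw [hβ.apply_singleton_of_notMem (x := 2 * x - 1) (by simp; intro; linarith), mul_zero,
          add_zero]
        exact mul_le_mul' (le_max_left _ _) (ih _)
      -- The midpoint has preimages in both branches, but the left one is the endpoint 1, already
      -- known to be null.
      · have : β {2 * x} = 0 := by
          rcases hx.eq_or_lt with hx | hx
          · rw [← hx]; norm_num [h1]
          · exact hβ.apply_singleton_of_notMem (by simp; intro; linarith)
        rw [this, mul_zero, zero_add]
        exact mul_le_mul' (le_max_right _ _) (ih _)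
  have hlim := ENNReal.tendsto_pow_atTop_nhds_zero_of_lt_one (max_lt hp hq)
  exact le_antisymm (ge_of_tendsto' hlim fun k => hk k x) bot_le

/-- For equal weights the constant family is dyadic, and masses determine dyadic families. This
identifies Lebesgue measure with the fair coin law. -/
theorem unique {β' : Measure ℝ} (hβ : IsBinarySelfSimilar (2⁻¹) (2⁻¹) β)
    (hβ' : IsBinarySelfSimilar (2⁻¹) (2⁻¹) β') : β = β' := by
  have := hβ.isProbabilityMeasure
  have := hβ'.isProbabilityMeasure
  have hfam : ∀ {μ : Measure ℝ}, IsBinarySelfSimilar (2⁻¹) (2⁻¹) μ →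
      IsDyadicFamily (2⁻¹ : ℝ≥0∞) (fun _ => μ) := fun h =>
    ⟨fun _ => by have := h.isProbabilityMeasure; infer_instance, fun _ => h.compl_Icc,
      fun _ _ => by rw [smul_add]; exact h.eq_add⟩
  exact IsDyadicFamily.ext (hfam hβ) (hfam hβ') (by simp)

end IsBinarySelfSimilar

theorem isBinarySelfSimilar_unitLebesgue : IsBinarySelfSimilar (2⁻¹) (2⁻¹) unitLebesgue :=
  ⟨inferInstance, unitLebesgue_compl_Icc, by rw [← smul_add]; exact unitLebesgue_eq⟩

/-! ### Singularity of biased Bernoulli measures -/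

/-- The `i`-th binary digit of the fractional part of `x`. -/
noncomputable def binaryDigit : ℕ → ℝ → ℝ
  | 0, x => if 1 / 2 ≤ Int.fract x then 1 else 0
  | i + 1, x => binaryDigit i (2 * x)

theorem measurable_binaryDigit (i : ℕ) : Measurable (binaryDigit i) := by
  induction i with
  | zero =>
    exact Measurable.ite (measurableSet_le measurable_const measurable_fract)
      measurable_const measurable_const
  | succ i ih => exact ih.comp (measurable_const_mul 2)

theorem binaryDigit_add_nat (i n : ℕ) (x : ℝ) : binaryDigit i (x + n) = binaryDigit i x := by
  induction i generalizing x n with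
  | zero => simp [binaryDigit]
  | succ i ih =>
    simp only [binaryDigit]
    rw [← ih (2 * n) (2 * x)]
    push_cast
    ring_nf

/-- The hypothesis excludes sequences ending in all ones, where the expansion differs from the one
read off by `binaryDigit`. -/
theorem binaryDigit_ofDigits {ω : ℕ → Fin 2}
    (h : ∀ j, Real.ofDigits (fun i => ω (i + j)) ≠ 1) (i : ℕ) :
    binaryDigit i (Real.ofDigits ω) = (ω i : ℕ) := by
  induction i generalizing ω with
  | zero =>
    have h1 := (Real.ofDigits_le_one (fun i => ω (i + 1))).lt_of_ne (h 1)
    have h0 := Real.ofDigits_nonneg (fun i => ω (i + 1))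
    rw [ofDigits_eq_dyadicBranch]
    generalize Real.ofDigits (fun i => ω (i + 1)) = y at *
    have hfr : Int.fract (dyadicBranch 1 (ω 0 : ℕ) y) = dyadicBranch 1 (ω 0 : ℕ) y := by
      rw [Int.fract_eq_self]
      have : ((ω 0 : ℕ) : ℝ) ≤ 1 := by exact_mod_cast Nat.lt_succ_iff.1 (ω 0).2
      simp only [dyadicBranch]
      constructor
      · positivity
      · linarith
    simp only [binaryDigit, hfr]
    rcases Fin.exists_fin_two.1 ⟨ω 0, rfl⟩ with h | h <;> rw [h] <;> simp [dyadicBranch]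
    · linarith
    · linarith
  | succ i ih =>
    have := ih (ω := fun i => ω (i + 1)) (fun j => by simpa [add_assoc, add_comm 1 j] using h (j + 1))
    rw [← this, binaryDigit, ofDigits_eq_dyadicBranch,
      ← binaryDigit_add_nat i (ω 0 : ℕ) (Real.ofDigits fun i => ω (i + 1))]
    congr 1
    simp only [dyadicBranch]
    ring

/-- The numbers whose binary digits average to `a`. -/
def digitFrequencySet (a : ℝ) : Set ℝ :=
  {x | Tendsto (fun n : ℕ => (∑ i ∈ Finset.range n, binaryDigit i x) / n) atTop (𝓝 a)}

theorem measurableSet_digitFrequencySet (a : ℝ) : MeasurableSet (digitFrequencySet a) :=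
  measurableSet_tendsto _ fun _ =>
    (Finset.measurable_sum _ fun i _ => measurable_binaryDigit i).div_const _

section Bernoulli

variable {p q : ℝ≥0∞}

theorem measurePreserving_shift (h : p + q = 1) (j : ℕ) :
    MeasurePreserving (fun (ω : ℕ → Fin 2) i => ω (i + j)) (bitSequenceMeasure p q)
      (bitSequenceMeasure p q) := by
  have := isProbabilityMeasure_bitMeasure h
  have hP := isProbabilityMeasure_bitSequenceMeasure h
  have hm : Measurable (fun (ω : ℕ → Fin 2) i => ω (i + 1)) :=
    measurable_pi_iff.2 fun i => measurable_pi_apply _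
  have hone : MeasurePreserving (fun (ω : ℕ → Fin 2) i => ω (i + 1)) (bitSequenceMeasure p q)
      (bitSequenceMeasure p q) := by
    refine ⟨hm, ?_⟩
    conv_lhs => rw [bitSequenceMeasure, ← map_consSeq_infinitePi,
      Measure.map_map hm measurable_consSeq]
    exact measurePreserving_snd.map_eq
  induction j with
  | zero => exact MeasurePreserving.id _
  | succ j ih =>
    convert! hone.comp ih using 1
    ext ω i
    simp [add_assoc, add_comm 1 j]

theorem ae_ofDigits_shift_ne_one (h : p + q = 1) (hp : p < 1) (hq : q < 1) :
    ∀ᵐ ω ∂(bitSequenceMeasure p q), ∀ j, Real.ofDigits (fun i => ω (i + j)) ≠ 1 := by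
  rw [ae_all_iff]
  intro j
  have h1 := (isBinarySelfSimilar_bernoulliMeasure h).noAtoms hp hq 1
  rw [bernoulliMeasure,
    Measure.map_apply measurable_ofDigits_two (measurableSet_singleton 1)] at h1
  have h2 : ∀ᵐ ω ∂(bitSequenceMeasure p q), Real.ofDigits ω ≠ 1 := by
    rw [ae_iff]
    convert! h1 using 2
    ext ω
    simp
  exact (measurePreserving_shift h j).quasiMeasurePreserving.ae h2

theorem ae_tendsto_average_bits (h : p + q = 1) :
    ∀ᵐ ω ∂(bitSequenceMeasure p q), Tendsto
      (fun n : ℕ => (∑ i ∈ Finset.range n, ((ω i : ℕ) : ℝ)) / n) atTop (𝓝 q.toReal) := by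
  have := isProbabilityMeasure_bitMeasure h
  have hP := isProbabilityMeasure_bitSequenceMeasure h
  have hq : q ≠ ∞ := fun hq => by simp [hq] at h
  have hp : p ≠ ∞ := fun hp => by simp [hp] at h
  let v : Fin 2 → ℝ := fun d => ((d : ℕ) : ℝ)
  have hv : Measurable v := measurable_of_finite v
  have hident : ∀ i, ProbabilityTheory.IdentDistrib (fun ω : ℕ → Fin 2 => v (ω i))
      (fun ω => v (ω 0)) (bitSequenceMeasure p q) (bitSequenceMeasure p q) := fun i =>
    ProbabilityTheory.IdentDistrib.comp (u := v)
      ⟨(measurable_pi_apply i).aemeasurable, (measurable_pi_apply 0).aemeasurable, by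
        rw [bitSequenceMeasure]
        exact (Measure.infinitePi_map_eval _ i).trans (Measure.infinitePi_map_eval (fun _ : ℕ => bitMeasure p q) 0).symm⟩ hv
  have hindep := ProbabilityTheory.iIndepFun_infinitePi (P := fun _ : ℕ => bitMeasure p q)
    (X := fun _ => v) (fun _ => hv)
  have hint : Integrable (fun ω : ℕ → Fin 2 => v (ω 0)) (bitSequenceMeasure p q) := by
    refine Integrable.of_bound (hv.comp (measurable_pi_apply 0)).aestronglyMeasurable 1
      (Eventually.of_forall fun ω => ?_)
    have : ((ω 0 : ℕ) : ℝ) ≤ 1 := by exact_mod_cast Nat.lt_succ_iff.1 (ω 0).2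
    simpa [v] using this
  have hmean : ∫ ω, v (ω 0) ∂(bitSequenceMeasure p q) = q.toReal := by
    have hmp := measurePreserving_eval_infinitePi (fun _ : ℕ => bitMeasure p q) 0
    have h1 : ∫ ω, v (ω 0) ∂(bitSequenceMeasure p q) = ∫ d, v d ∂(bitMeasure p q) := by
      rw [← hmp.map_eq, integral_map hmp.measurable.aemeasurable hv.aestronglyMeasurable]
      rfl
    rw [h1, bitMeasure, integral_add_measure, integral_smul_measure, integral_smul_measure,
      integral_dirac, integral_dirac]
    · simp [v]
    · exact Integrable.smul_measure Integrable.of_finite hp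
    · exact Integrable.smul_measure Integrable.of_finite hq
  have := ProbabilityTheory.strong_law_ae_real (fun i (ω : ℕ → Fin 2) => v (ω i)) hint
    (fun i j hij => hindep.indepFun hij) hident
  rw [hmean] at this
  exact this

theorem bernoulliMeasure_compl_digitFrequencySet (h : p + q = 1) (hp : p < 1) (hq : q < 1) :
    bernoulliMeasure p q (digitFrequencySet q.toReal)ᶜ = 0 := by
  rw [bernoulliMeasure, Measure.map_apply measurable_ofDigits_two
    (measurableSet_digitFrequencySet _).compl]
  have : ∀ᵐ ω ∂(bitSequenceMeasure p q), Real.ofDigits ω ∈ digitFrequencySet q.toReal := by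
    filter_upwards [ae_ofDigits_shift_ne_one h hp hq, ae_tendsto_average_bits h] with ω h1 h2
    simp only [digitFrequencySet, Set.mem_ofPred_eq, binaryDigit_ofDigits h1]
    exact h2
  exact this

/-- The strong law gives digit frequency `q` almost surely for the biased measure and `1/2` for
Lebesgue measure. -/
theorem bernoulliMeasure_mutuallySingular (h : p + q = 1) (hp : p < 1) (hq : q < 1)
    (hpq : p ≠ q) : bernoulliMeasure p q ⟂ₘ (volume : Measure ℝ) := by
  have hhalf : (2⁻¹ : ℝ≥0∞) + 2⁻¹ = 1 := ENNReal.inv_two_add_inv_two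
  have hlt : (2⁻¹ : ℝ≥0∞) < 1 := by simp
  have hL : unitLebesgue (digitFrequencySet (2⁻¹ : ℝ≥0∞).toReal)ᶜ = 0 := by
    rw [isBinarySelfSimilar_unitLebesgue.unique (isBinarySelfSimilar_bernoulliMeasure hhalf)]
    exact bernoulliMeasure_compl_digitFrequencySet hhalf hlt hlt
  have hne : q.toReal ≠ (2⁻¹ : ℝ≥0∞).toReal := by
    intro h'
    have hq' : q = 2⁻¹ := (ENNReal.toReal_eq_toReal_iff' hq.ne_top (by simp)).1 h'
    rw [hq', ← hhalf] at h
    exact hpq (((ENNReal.add_left_inj (by simp)).1 h).trans hq'.symm)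
  have hL' : unitLebesgue (digitFrequencySet q.toReal) = 0 :=
    measure_mono_null (fun x hx hx' => hne (tendsto_nhds_unique hx hx')) hL
  have hβ := isBinarySelfSimilar_bernoulliMeasure h
  -- Nullity is known only inside the unit interval, hence the intersection; the endpoint 0 it loses
  -- is not an atom.
  refine ⟨(digitFrequencySet q.toReal ∩ Set.Ioc 0 1)ᶜ,
    ((measurableSet_digitFrequencySet _).inter measurableSet_Ioc).compl, ?_, ?_⟩
  · rw [Set.compl_inter]
    refine measure_union_null (bernoulliMeasure_compl_digitFrequencySet h hp hq) ?_
    have : (Set.Ioc (0 : ℝ) 1)ᶜ ⊆ (Set.Icc 0 1)ᶜ ∪ {0} := by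
      intro x hx
      simp only [Set.mem_compl_iff, Set.mem_Ioc, Set.mem_union, Set.mem_Icc,
        Set.mem_singleton_iff] at *
      grind
    exact measure_mono_null this (measure_union_null hβ.compl_Icc (hβ.noAtoms hp hq 0))
  · rw [compl_compl, ← Measure.restrict_apply (measurableSet_digitFrequencySet _)]
    exact hL'

end Bernoulli

/-! ### Lebesgue type of the superposition -/

theorem dyadicBranch_measurableEmbedding (k d : ℕ) : MeasurableEmbedding (dyadicBranch k d) :=
  (continuous_dyadicBranch k d).measurableEmbedding (dyadicBranch_injective k d)

section NodeMeasure

variable {α : ℝ≥0∞} {b₀ b₁ : ℕ} {f : ℕ → ℕ} {β : Measure ℝ}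

theorem nodeMeasure_singleton (hβ : ∀ x, β {x} = 0) (m : ℕ) :
    ∀ x, nodeMeasure α b₀ b₁ f β m {x} = 0 := by
  refine induction_sourceSum (Q := fun μ => ∀ x, μ {x} = 0) ?_ ?_ ?_ ?_ hβ _ _ _ _
  · intro c μ h x; simp [h]
  · intro μ ν h h' x; simp [h, h']
  · intro μ h x; simp [Measure.sum_apply _ (measurableSet_singleton x), h]
  · intro d _ μ h x
    rw [Measure.map_apply (measurable_dyadicBranch _ _) (measurableSet_singleton x)]
    rcases (Set.subsingleton_singleton.preimage (dyadicBranch_injective 1 d)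
      (s := {x})).eq_empty_or_singleton with h' | ⟨y, h'⟩
    · rw [h', measure_empty]
    · rw [h', h]

theorem nodeMeasure_mutuallySingular (hβ : β ⟂ₘ (volume : Measure ℝ)) (m : ℕ) :
    nodeMeasure α b₀ b₁ f β m ⟂ₘ (volume : Measure ℝ) := by
  refine induction_sourceSum (Q := fun μ => μ ⟂ₘ (volume : Measure ℝ)) ?_ ?_ ?_ ?_
    hβ _ _ _ _
  · exact fun c μ h => h.smul c
  · exact fun μ ν h h' => h.add_left h'
  · exact fun μ h => Measure.MutuallySingular.sum_left.2 h
  · intro d _ μ h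
    have h' := (dyadicBranch_measurableEmbedding 1 d).mutuallySingular_map h
    rw [map_dyadicBranch_one_volume] at h'
    exact h'.mono_ac Measure.AbsolutelyContinuous.rfl
      (Measure.absolutelyContinuous_smul (by norm_num))

theorem nodeMeasure_absolutelyContinuous (hβ : β ≪ unitLebesgue) (m : ℕ) :
    nodeMeasure α b₀ b₁ f β m ≪ unitLebesgue := by
  refine induction_sourceSum (Q := fun μ => μ ≪ unitLebesgue) ?_ ?_ ?_ ?_ hβ _ _ _ _
  · exact fun c μ h => h.smul_left c
  · exact fun μ ν h h' => Measure.AbsolutelyContinuous.add_left h h'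
  · exact fun μ h => Measure.absolutelyContinuous_sum_left h
  · intro d hd μ h
    refine (h.map (measurable_dyadicBranch 1 d)).trans ?_
    refine Measure.AbsolutelyContinuous.mk fun s hs h0 => ?_
    -- Self-similarity of Lebesgue measure makes the preimages of a null set under both branches
    -- null.
    rw [unitLebesgue_eq] at h0
    simp only [Measure.smul_apply, Measure.add_apply, smul_eq_mul, mul_eq_zero,
      ENNReal.inv_eq_zero, ENNReal.ofNat_ne_top, false_or, add_eq_zero] at h0
    interval_cases d
    · exact h0.1
    · exact h0.2

theorem nodeMeasure_countable_carrier (hβ : ∃ C : Set ℝ, C.Countable ∧ β Cᶜ = 0) (m : ℕ) :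
    ∃ C : Set ℝ, C.Countable ∧ nodeMeasure α b₀ b₁ f β m Cᶜ = 0 := by
  refine induction_sourceSum (Q := fun μ => ∃ C : Set ℝ, C.Countable ∧ μ Cᶜ = 0)
    ?_ ?_ ?_ ?_ hβ _ _ _ _
  · rintro c μ ⟨C, hC, h⟩
    exact ⟨C, hC, by simp [h]⟩
  · rintro μ ν ⟨C, hC, h⟩ ⟨D, hD, h'⟩
    refine ⟨C ∪ D, hC.union hD, ?_⟩
    rw [Measure.add_apply, measure_mono_null (Set.compl_subset_compl.2 Set.subset_union_left) h,
      measure_mono_null (Set.compl_subset_compl.2 Set.subset_union_right) h', add_zero]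
  · intro μ h
    choose C hC h using h
    have hU := Set.countable_iUnion hC
    refine ⟨⋃ j, C j, hU, ?_⟩
    rw [Measure.sum_apply _ hU.measurableSet.compl, ENNReal.tsum_eq_zero]
    exact fun j => measure_mono_null (Set.compl_subset_compl.2 (Set.subset_iUnion C j)) (h j)
  · rintro d _ μ ⟨C, hC, h⟩
    have hI := hC.image (dyadicBranch 1 d)
    refine ⟨_, hI, ?_⟩
    rw [Measure.map_apply (measurable_dyadicBranch _ _) hI.measurableSet.compl]
    exact measure_mono_null (fun x hx hx' => hx ⟨x, hx', rfl⟩) h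

end NodeMeasure

/-! ### Lebesgue type of the projection to the torus -/

theorem normalizedPush_apply (μ : Measure ℝ) {s : Set UnitAddCircle} (hs : MeasurableSet s) :
    normalizedPush μ s = (μ Set.univ)⁻¹ * μ (((↑) : ℝ → UnitAddCircle) ⁻¹' s) := by
  rw [normalizedPush, Measure.map_apply AddCircle.measurable_mk' hs]
  rfl

theorem countable_preimage_mk_singleton (x : UnitAddCircle) :
    (((↑) : ℝ → UnitAddCircle) ⁻¹' {x}).Countable := by
  obtain ⟨y, rfl⟩ := QuotientAddGroup.mk_surjective x
  refine (Set.countable_range fun n : ℤ => y + n).mono fun z hz => ?_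
  have h : ((z - y : ℝ) : UnitAddCircle) = 0 := by
    rw [AddCircle.coe_sub, sub_eq_zero]; exact hz
  obtain ⟨n, hn⟩ := (AddCircle.coe_eq_zero_iff 1).1 h
  exact ⟨n, by simp at hn; simp only [hn]; ring⟩

/-- Fibres of the projection are countable, so atoms cannot appear. A separating set is carried to
the torus by the section `φ` with values in `(0, 1]`, whose complement is null for `μ`. -/
theorem isSingularContinuous_normalizedPush {μ : Measure ℝ} (h0 : ∀ x, μ {x} = 0)
    (hI : μ (Set.Icc 0 1)ᶜ = 0) (hs : μ ⟂ₘ (volume : Measure ℝ)) :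
    IsSingularContinuous (normalizedPush μ) := by
  refine ⟨fun x => ?_, ?_⟩
  · rw [normalizedPush_apply _ (measurableSet_singleton x)]
    have : μ (((↑) : ℝ → UnitAddCircle) ⁻¹' {x}) = 0 := by
      rw [← Set.biUnion_of_singleton (((↑) : ℝ → UnitAddCircle) ⁻¹' {x}),
        measure_biUnion_null_iff (countable_preimage_mk_singleton x)]
      exact fun y _ => h0 y
    rw [this, mul_zero]
  · obtain ⟨s, hsm, h1, h2⟩ := hs
    let φ : UnitAddCircle → ℝ := fun x => (AddCircle.measurableEquivIoc (1 : ℝ) 0 x : ℝ)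
    have hφ : Measurable φ :=
      measurable_subtype_coe.comp (AddCircle.measurableEquivIoc (1 : ℝ) 0).measurable
    have hφ' : ∀ y ∈ Set.Ioc (0 : ℝ) 1, φ (y : UnitAddCircle) = y := fun y hy =>
      AddCircle.equivIoc_coe_of_mem (p := (1 : ℝ)) (a := 0) (by simpa using hy)
    refine ⟨φ ⁻¹' s, hφ hsm, ?_, ?_⟩
    · rw [normalizedPush_apply _ (hφ hsm)]
      have : ((↑) : ℝ → UnitAddCircle) ⁻¹' (φ ⁻¹' s) ⊆ s ∪ ((Set.Icc 0 1)ᶜ ∪ {0}) := by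
        intro y hy
        by_cases hy' : y ∈ Set.Ioc (0 : ℝ) 1
        · left
          rw [Set.mem_preimage, Set.mem_preimage, hφ' y hy'] at hy
          exact hy
        · right
          simp only [Set.mem_compl_iff, Set.mem_Ioc, Set.mem_union, Set.mem_Icc,
            Set.mem_singleton_iff] at *
          grind
      rw [measure_mono_null this (measure_union_null h1 (measure_union_null hI (h0 0))), mul_zero]
    · rw [← Set.preimage_compl, ← normalizedPush_unitLebesgue,
        normalizedPush_apply _ (hφ hsm.compl), unitLebesgue,
        Measure.restrict_apply (AddCircle.measurable_mk' (hφ hsm.compl))]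
      have : ((↑) : ℝ → UnitAddCircle) ⁻¹' (φ ⁻¹' sᶜ) ∩ Set.Ioc 0 1 ⊆ sᶜ := by
        rintro y ⟨hy, hy'⟩
        rw [Set.mem_preimage, Set.mem_preimage, hφ' y hy'] at hy
        exact hy
      rw [measure_mono_null this h2, mul_zero]

theorem isAbsContinuous_of_absolutelyContinuous {μ : Measure UnitAddCircle} [IsFiniteMeasure μ]
    (h : μ ≪ volume) : IsAbsContinuous μ := by
  refine ⟨fun x => (μ.rnDeriv volume x).toReal, Measure.integrable_toReal_rnDeriv,
    fun x => ENNReal.toReal_nonneg, ?_⟩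
  conv_lhs => rw [← Measure.withDensity_rnDeriv_eq μ volume h]
  refine withDensity_congr_ae ?_
  filter_upwards [Measure.rnDeriv_lt_top μ volume] with x hx
  rw [ENNReal.ofReal_toReal hx.ne]

theorem normalizedPush_absolutelyContinuous {μ : Measure ℝ} (h : μ ≪ unitLebesgue) :
    normalizedPush μ ≪ volume := by
  rw [← normalizedPush_unitLebesgue, normalizedPush, normalizedPush, unitLebesgue_univ, inv_one,
    one_smul]
  exact (h.smul_left _).map AddCircle.measurable_mk'

theorem isPurePoint_of_countable_carrier {μ : Measure UnitAddCircle} {C : Set UnitAddCircle}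
    (hC : C.Countable) (h : μ Cᶜ = 0) : IsPurePoint μ := by
  -- Adding 0 makes the carrier nonempty and so enumerable by `ℕ`; `disjointed` then counts repeated
  -- points once.
  obtain ⟨u, hu⟩ := (hC.insert 0).exists_eq_range (Set.insert_nonempty _ _)
  let D : ℕ → Set UnitAddCircle := disjointed fun i => {u i}
  have hD : ∀ i, D i ⊆ {u i} := disjointed_subset _
  have hDm : ∀ i, MeasurableSet (D i) := MeasurableSet.disjointed fun i => measurableSet_singleton _
  refine ⟨fun i => μ (D i), u, ?_⟩
  have hU : ⋃ i, D i = insert 0 C := by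
    rw [iUnion_disjointed, hu, Set.iUnion_singleton_eq_range]
  have h1 : μ = μ.restrict (⋃ i, D i) := by
    rw [hU, eq_comm, Measure.restrict_eq_self_of_ae_mem]
    exact measure_mono_null (Set.compl_subset_compl.2 (Set.subset_insert 0 C)) h
  conv_lhs => rw [h1, Measure.restrict_iUnion (disjoint_disjointed _) hDm]
  congr 1
  ext i s hs
  rw [Measure.restrict_apply hs, Measure.smul_apply, Measure.dirac_apply' _ hs, smul_eq_mul]
  by_cases hi : u i ∈ s
  · have : s ∩ D i = D i := Set.inter_eq_right.2 ((hD i).trans (by simpa using hi))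
    change μ (s ∩ D i) = _
    simp [this, hi]
  · have : s ∩ D i = ∅ := by
      ext x
      simp only [Set.mem_inter_iff, Set.mem_empty_iff_false, iff_false, not_and]
      intro hx hx'
      exact hi (by rwa [← Set.mem_singleton_iff.1 (hD i hx')])
    change μ (s ∩ D i) = _
    simp [this, hi]

theorem isPurePoint_normalizedPush {μ : Measure ℝ} (h : ∃ C : Set ℝ, C.Countable ∧ μ Cᶜ = 0) :
    IsPurePoint (normalizedPush μ) := by
  obtain ⟨C, hC, h0⟩ := h
  have hI := hC.image ((↑) : ℝ → UnitAddCircle)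
  refine isPurePoint_of_countable_carrier hI ?_
  have hsub : ((↑) : ℝ → UnitAddCircle) ⁻¹' (((↑) : ℝ → UnitAddCircle) '' C)ᶜ ⊆ Cᶜ :=
    fun x hx hx' => hx ⟨x, hx', rfl⟩
  rw [normalizedPush_apply _ hI.measurableSet.compl, measure_mono_null hsub h0, mul_zero]

/-! ### Degenerate self-similar measures -/

theorem isBinarySelfSimilar_dirac_zero : IsBinarySelfSimilar 1 0 (Measure.dirac 0) := by
  refine ⟨inferInstance, by simp, ?_⟩
  simp [Measure.map_dirac' (measurable_dyadicBranch _ _), dyadicBranch]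

theorem isBinarySelfSimilar_dirac_one : IsBinarySelfSimilar 0 1 (Measure.dirac 1) := by
  refine ⟨inferInstance, by simp, ?_⟩
  have : dyadicBranch 1 1 1 = 1 := by norm_num [dyadicBranch]
  simp [Measure.map_dirac' (measurable_dyadicBranch _ _), this]

theorem normalizedPush_dirac (x : ℝ) :
    normalizedPush (Measure.dirac x) = Measure.dirac (x : UnitAddCircle) := by
  simp [normalizedPush, Measure.map_dirac' AddCircle.measurable_mk']

theorem exists_countable_carrier_dirac (x : ℝ) :
    ∃ C : Set ℝ, C.Countable ∧ Measure.dirac x Cᶜ = 0 :=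
  ⟨{x}, Set.countable_singleton x, by simp⟩

/-- Without source terms a zero at the root propagates to all descendants, that is, to every `n ≥
1`. -/
theorem IsAffineTwoRegular.apply_one_ne_zero {A₀ A₁ : ℕ} {f : ℕ → ℕ}
    (hf : IsAffineTwoRegular A₀ A₁ 0 0 f) (h : ∃ n, 1 ≤ n ∧ f n ≠ 0) : f 1 ≠ 0 := by
  intro h1
  obtain ⟨n, hn, hne⟩ := h
  refine hne ?_
  clear hne
  induction n using Nat.strong_induction_on with
  | _ n ih =>
    rcases hn.eq_or_lt with rfl | hn'
    · exact h1
    · have hk := ih (n / 2) (by omega) (by omega)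
      obtain ⟨h0, h1⟩ := hf (n / 2) (by omega)
      rcases Nat.mod_two_eq_zero_or_one n with hm | hm
      · rw [show n = 2 * (n / 2) by omega, h0, hk]; simp
      · rw [show n = 2 * (n / 2) + 1 by omega, h1, hk]; simp

/-! ### Assembly of the cases -/

theorem theorem1 (A₀ A₁ b₀ b₁ : ℕ) (hcoeff : ¬ (A₀ = 0 ∧ A₁ = 0 ∧ b₀ = 0 ∧ b₁ = 0))
    (f : ℕ → ℕ) (hf : IsAffineTwoRegular A₀ A₁ b₀ b₁ f) (hf0 : ∃ n : ℕ, 1 ≤ n ∧ f n ≠ 0) :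
    ∃ μ : Measure UnitAddCircle,
      IsGhostMeasure f μ ∧ (∀ ν : Measure UnitAddCircle, IsGhostMeasure f ν → ν = μ) ∧
      IsProbabilityMeasure μ ∧
      -- homogeneous case
      (b₀ = 0 ∧ b₁ = 0 →
        (A₀ = A₁ ∧ A₀ ≠ 0 → μ = volume) ∧
        (A₀ ≠ A₁ ∧ A₀ ≠ 0 ∧ A₁ ≠ 0 → IsSingularContinuous μ) ∧
        (A₀ = 0 ∨ A₁ = 0 → IsPurePoint μ ∧ μ = Measure.dirac 0)) ∧
      -- inhomogeneous case
      (b₀ + b₁ ≠ 0 →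
        (A₀ + A₁ ≤ 2 → μ = volume) ∧
        (A₀ = A₁ ∧ 1 < A₀ → IsAbsContinuous μ) ∧
        (A₀ ≠ A₁ ∧ A₀ ≠ 0 ∧ A₁ ≠ 0 → IsSingularContinuous μ) ∧
        ((A₀ = 0 ∧ 2 < A₁) ∨ (A₁ = 0 ∧ 2 < A₀) → IsPurePoint μ)) := by
  by_cases hsmall : b₀ + b₁ ≠ 0 ∧ A₀ + A₁ ≤ 2
  · obtain ⟨hB, hA⟩ := hsmall
    have hμ := hf.isGhostMeasure_volume hB hA
    exact ⟨volume, hμ, fun ν hν => hμ.unique hν, ⟨by simp⟩, fun h => by omega,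
      fun _ => ⟨fun _ => rfl, fun h => by omega, fun h => by omega, fun h => by omega⟩⟩
  have hAB : (b₀ + b₁ = 0 ∧ f 1 ≠ 0) ∨ (b₀ + b₁ ≠ 0 ∧ 2 < A₀ + A₁) := by
    by_cases hB : b₀ + b₁ = 0
    · obtain ⟨rfl, rfl⟩ : b₀ = 0 ∧ b₁ = 0 := by omega
      exact Or.inl ⟨hB, hf.apply_one_ne_zero hf0⟩
    · exact Or.inr ⟨hB, by omega⟩
  have hA : 0 < A₀ + A₁ := by omega
  have hAB' : b₀ + b₁ = 0 ∨ 2 < A₀ + A₁ := hAB.imp (·.1) (·.2)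
  have hA' : ((A₀ + A₁ : ℕ) : ℝ≥0∞) ≠ 0 := by exact_mod_cast hA.ne'
  have hAtop := ENNReal.natCast_ne_top (A₀ + A₁)
  obtain ⟨α, hα⟩ : ∃ α : ℝ≥0∞, α = ((A₀ + A₁ : ℕ) : ℝ≥0∞)⁻¹ := ⟨_, rfl⟩
  have hsum : α * A₀ + α * A₁ = 1 := by
    rw [← mul_add, ← Nat.cast_add, hα, ENNReal.inv_mul_cancel hA' hAtop]
  by_cases heq : A₀ = A₁
  · have hhalf : α * A₀ = 2⁻¹ := by
      rw [← heq, ← two_mul] at hsum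
      exact ENNReal.eq_inv_of_mul_eq_one_left (by rwa [mul_comm])
    obtain ⟨hμ, hprob⟩ := hf.isGhostMeasure_nodeMeasure isBinarySelfSimilar_unitLebesgue hA hα
      hhalf (heq ▸ hhalf) hAB
    refine ⟨_, hμ, fun ν hν => hμ.unique hν, hprob, fun hb => ⟨fun _ => ?_, fun h => by omega,
      fun h => by omega⟩, fun hb => ⟨fun h => by omega, fun _ => ?_, fun h => by omega,
      fun h => by omega⟩⟩
    · obtain ⟨rfl, rfl⟩ := hb
      rw [normalizedPush_nodeMeasure_of_homogeneous (by omega), normalizedPush_unitLebesgue]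
    · exact isAbsContinuous_of_absolutelyContinuous (normalizedPush_absolutelyContinuous
        (nodeMeasure_absolutelyContinuous Measure.AbsolutelyContinuous.rfl 1))
  by_cases hzero : A₀ = 0 ∨ A₁ = 0
  -- The point mass sits at 1 if `A₀ = 0` and at 0 if `A₁ = 0`; both endpoints project to the same
  -- point of the torus.
  · obtain ⟨x, hx, hsim⟩ : ∃ x : ℝ, (x : UnitAddCircle) = 0 ∧
        IsBinarySelfSimilar (α * A₀) (α * A₁) (Measure.dirac x) := by
      rcases hzero with rfl | rfl
      · refine ⟨1, AddCircle.coe_period 1, ?_⟩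
        rw [Nat.cast_zero, mul_zero, zero_add] at hsum
        rw [hsum, Nat.cast_zero, mul_zero]
        exact isBinarySelfSimilar_dirac_one
      · refine ⟨0, rfl, ?_⟩
        rw [Nat.cast_zero, mul_zero, add_zero] at hsum
        rw [hsum, Nat.cast_zero, mul_zero]
        exact isBinarySelfSimilar_dirac_zero
    obtain ⟨hμ, hprob⟩ := hf.isGhostMeasure_nodeMeasure hsim hA hα rfl rfl hAB
    have hpp : IsPurePoint (normalizedPush (nodeMeasure α b₀ b₁ f (Measure.dirac x) 1)) :=
      isPurePoint_normalizedPush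
        (nodeMeasure_countable_carrier (exists_countable_carrier_dirac x) 1)
    refine ⟨_, hμ, fun ν hν => hμ.unique hν, hprob, fun hb => ⟨fun h => by omega,
      fun h => by omega, fun _ => ⟨hpp, ?_⟩⟩, fun hb => ⟨fun h => by omega, fun h => by omega,
      fun h => by omega, fun _ => hpp⟩⟩
    obtain ⟨rfl, rfl⟩ := hb
    rw [normalizedPush_nodeMeasure_of_homogeneous (by omega), normalizedPush_dirac, hx]
  · push Not at hzero
    have hlt : ∀ a : ℕ, a < A₀ + A₁ → α * a < 1 := fun a ha => by
      rw [hα, mul_comm, ← div_eq_mul_inv, ENNReal.div_lt_iff (Or.inl hA') (Or.inl hAtop), one_mul]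
      exact_mod_cast ha
    have hp := hlt A₀ (by omega)
    have hq := hlt A₁ (by omega)
    have hne : α * A₀ ≠ α * A₁ := by
      intro h
      have hα0 : α ≠ 0 := by rw [hα]; exact ENNReal.inv_ne_zero.2 hAtop
      have hαt : α ≠ ∞ := by rw [hα]; exact ENNReal.inv_ne_top.2 hA'
      exact heq (by exact_mod_cast (ENNReal.mul_right_inj hα0 hαt).1 h)
    have hsim := isBinarySelfSimilar_bernoulliMeasure hsum
    obtain ⟨hμ, hprob⟩ := hf.isGhostMeasure_nodeMeasure hsim hA hα rfl rfl hAB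
    have hsc := isSingularContinuous_normalizedPush
      (nodeMeasure_singleton (α := α) (b₀ := b₀) (b₁ := b₁) (f := f) (hsim.noAtoms hp hq) 1)
      ((hf.isDyadicFamily_nodeMeasure hsim hα rfl rfl hAB').compl_Icc 1)
      (nodeMeasure_mutuallySingular (bernoulliMeasure_mutuallySingular hsum hp hq hne) 1)
    exact ⟨_, hμ, fun ν hν => hμ.unique hν, hprob, fun _ => ⟨fun h => by omega, fun _ => hsc,
      fun h => by omega⟩, fun _ => ⟨fun h => by omega, fun h => by omega, fun _ => hsc,
      fun h => by omega⟩⟩
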